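/- Let $(\Omega,\mathcal F,P)$ be an atomless probability space and let $\alpha\in(0,1/2]$. For $L\in L^1$ and $u\in(0,1/2]$ let $e_u(L)$ be the unique real number $e$ with $(1-u)E[(L-e)^+]=u\,E[(L-e)^-]$; for $t\in(0,1)$ let $q_t(L)=\inf\{m\in\mathbb R: P[L\le m]\ge 1-t\}$; and put $$es_\alpha(L)=\frac1\alpha\int_0^\alpha e_u(L)\,du .$$ Define $\varphi:[0,1]\to[0,1]$ by $\varphi(0)=0$, $\varphi(1/2)=1-\alpha/2$ and $$\varphi(t)=-\frac{t}{1-2t}\left[1-\frac{1-t}{\alpha(1-2t)}\ln\left(1-2\alpha+\frac{\alpha}{t}\right)\right]\qquad (t\ne 0,1/2).$$ Then $\varphi$ is a concave distortion function, i.e. it is concave and nondecreasing with $\varphi(0)=0$, $\varphi(1)=1$. With $\varphi'_+$ its right derivative, $$-\infty<es_\alpha(L)\le R_\varphi(L):=\int_0^1\varphi'_+(t)\,q_t(L)\,dt\le\infty\qquad\text{for every } L\in L^1,$$ where both integrals are well defined in $(-\infty,\infty]$. Moreover, $R_\varphi$ is the smallest law invariant, coherent and comonotonic risk measure dominating $es_\alpha$: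 it is itself such a risk measure $L^1\to(-\infty,\infty]$, and $R_\varphi(L)\le R(L)$ for all $L\in L^1$ whenever $R:L^1\to(-\infty,\infty]$ is law invariant, coherent, comonotonic and satisfies $es_\alpha\le R$ on $L^1$. In particular, $es_\alpha(1_A)=R_\varphi(1_A)=\varphi(P[A])$ for each $A\in\mathcal F$. Here $R:L^1\to(-\infty,\infty]$ is law invariant if $R(L_1)=R(L_2)$ whenever $L_1$ and $L_2$ have the same distribution; coherent if it is monotone ($L_1\le L_2$ implies $R(L_1)\le R(L_2)$), cash-invariant ($R(L-m)=R(L)-m$ for $m\in\mathbb R$), sub-additive, and positively homogeneous ($R(\lambda L)=\lambda R(L)$ for $\lambda\ge0$, with $0\cdot\infty=0$); and comonotonic if $R(L_1+L_2)=R(L_1)+R(L_2)$ whenever $L_1,L_2\in L^1$ have versions with $(L_1(\omega)-L_1(\omega'))(L_2(\omega)-L_2(\omega'))\ge0$ for all $\omega,\omega'\in\Omega$. -/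

import Mathlib

open MeasureTheory Set

namespace ExpectileRisk

/-- The measure has no atoms in the measure-theoretic sense: every measurable set of positive
measure has a measurable subset of strictly smaller positive measure. (Mathlib's `NoAtoms` only
says that points are null.) -/
def IsAtomless {Ω : Type*} [MeasurableSpace Ω] (P : Measure Ω) : Prop :=
  ∀ A : Set Ω, MeasurableSet A → 0 < P A → ∃ B ⊆ A, MeasurableSet B ∧ 0 < P B ∧ P B < P A

/-! ### Expectiles and quantiles -/

/-- `m` solves the first order condition of the expectile of `X` at level `u`. -/
def IsExpectile {Ω : Type*} [MeasurableSpace Ω] (P : Measure Ω) (u : ℝ) (X : Ω → ℝ) (m : ℝ) :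
    Prop :=
  (1 - u) * ∫ ω, (X ω - m)⁺ ∂P = u * ∫ ω, (X ω - m)⁻ ∂P

/-- For integrable `X` and `0 < u ≤ 1/2` the first order condition has exactly one solution. -/
theorem existsUnique_isExpectile {Ω : Type*} [MeasurableSpace Ω] (P : Measure Ω)
    [IsProbabilityMeasure P] {u : ℝ} (hu : 0 < u) (hu' : u ≤ 1 / 2) {X : Ω → ℝ}
    (hX : Integrable X P) : ∃! m, IsExpectile P u X m := by
  have hp : ∀ m : ℝ, Integrable (fun ω => (X ω - m)⁺) P := fun m =>
    (hX.sub (integrable_const m)).pos_part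
  have hn : ∀ m : ℝ, Integrable (fun ω => (X ω - m)⁻) P := fun m =>
    (hX.sub (integrable_const m)).neg_part
  set h : ℝ → ℝ := fun x => (1 - u) * x⁺ - u * x⁻ with hh
  have hint : ∀ m : ℝ, Integrable (fun ω => h (X ω - m)) P := fun m =>
    ((hp m).const_mul _).sub ((hn m).const_mul _)
  set g : ℝ → ℝ := fun m => ∫ ω, h (X ω - m) ∂P with hg
  have hiff : ∀ m, IsExpectile P u X m ↔ g m = 0 := by
    intro m
    have : g m = (1 - u) * ∫ ω, (X ω - m)⁺ ∂P - u * ∫ ω, (X ω - m)⁻ ∂P := by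
      rw [← integral_const_mul, ← integral_const_mul,
        ← integral_sub ((hp m).const_mul _) ((hn m).const_mul _)]
    rw [this, sub_eq_zero]; rfl
  have hb : ∀ x y : ℝ, x ≤ y → u * (y - x) ≤ h y - h x ∧ h y - h x ≤ 1 * (y - x) := by
    intro x y hxy
    simp only [hh, posPart_def, negPart_def]
    rcases le_total x 0 with hx | hx <;> rcases le_total y 0 with hy | hy <;>
      simp only [hx, hy, sup_of_le_left, sup_of_le_right, Left.nonneg_neg_iff,
        Left.neg_nonpos_iff] <;> constructor <;> nlinarith
  have hgb : ∀ m n : ℝ, m ≤ n → u * (n - m) ≤ g m - g n ∧ g m - g n ≤ 1 * (n - m) := by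
    intro m n hmn
    have e : g m - g n = ∫ ω, (h (X ω - m) - h (X ω - n)) ∂P :=
      (integral_sub (hint m) (hint n)).symm
    have c : ∀ c : ℝ, c = ∫ _, c ∂P := fun c => by simp
    rw [e]
    constructor
    · rw [c (u * (n - m))]
      refine integral_mono (integrable_const _) ((hint m).sub (hint n)) fun ω => ?_
      have := (hb (X ω - n) (X ω - m) (by linarith)).1
      simp only; linarith
    · rw [c (1 * (n - m))]
      refine integral_mono ((hint m).sub (hint n)) (integrable_const _) fun ω => ?_
      have := (hb (X ω - n) (X ω - m) (by linarith)).2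
      simp only; linarith
  have hcont : Continuous g := by
    refine (LipschitzWith.of_dist_le_mul (K := 1) fun m n => ?_).continuous
    rw [Real.dist_eq, Real.dist_eq, NNReal.coe_one]
    rcases le_total m n with hmn | hmn
    · obtain ⟨h1, h2⟩ := hgb m n hmn
      rw [abs_of_nonneg (by nlinarith), abs_of_nonpos (by linarith)]; linarith
    · obtain ⟨h1, h2⟩ := hgb n m hmn
      rw [abs_of_nonpos (by nlinarith), abs_of_nonneg (by linarith)]; linarith
  set B : ℝ := |g 0| / u with hB
  have hB0 : 0 ≤ B := by positivity
  have hBu : u * B = |g 0| := by rw [hB]; field_simp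
  have hlo : g B ≤ 0 := by
    have := (hgb 0 B hB0).1
    have := le_abs_self (g 0)
    linarith
  have hhi : 0 ≤ g (-B) := by
    have := (hgb (-B) 0 (by linarith)).1
    have := neg_abs_le (g 0)
    linarith
  obtain ⟨m, -, hm⟩ := intermediate_value_Icc' (show -B ≤ B by linarith) hcont.continuousOn
    ⟨hlo, hhi⟩
  refine ⟨m, (hiff m).2 hm, fun n hn' => ?_⟩
  have hn0 := (hiff n).1 hn'
  rcases le_total m n with hmn | hmn
  · have := (hgb m n hmn).1
    nlinarith
  · have := (hgb n m hmn).1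
    nlinarith

/-- The expectile `e_u(X)`: the solution of the first order condition, which exists and is unique
for integrable `X` and `0 < u ≤ 1/2`. -/
noncomputable def expectile {Ω : Type*} [MeasurableSpace Ω] (P : Measure Ω) (u : ℝ) (X : Ω → ℝ) :
    ℝ :=
  Classical.epsilon (IsExpectile P u X)

/-- The upper-tail quantile (value at risk) `q_t(X) = inf {m | F_X(m) ≥ 1 - t}`, `0 < t < 1`. -/
noncomputable def quantile {Ω : Type*} [MeasurableSpace Ω] (P : Measure Ω) (t : ℝ) (X : Ω → ℝ) :
    ℝ :=
  sInf {m : ℝ | 1 - t ≤ P.real {ω | X ω ≤ m}}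

/-- The Lebesgue integral over `s` with values in `[-∞, ∞]`: integral of the positive part minus
integral of the negative part. It equals `⊥` as soon as the negative part has infinite integral,
so a value other than `⊥` means that the integral is well defined in `(-∞, ∞]`. -/
noncomputable def extIntegral (s : Set ℝ) (f : ℝ → ℝ) : EReal :=
  ((∫⁻ t in s, ENNReal.ofReal (f t) : ENNReal) : EReal) -
    ((∫⁻ t in s, ENNReal.ofReal (-f t) : ENNReal) : EReal)

/-- The expectile based expected shortfall `es_α(L) = α⁻¹ ∫_0^α e_u(L) du`. -/
noncomputable def expectileES {Ω : Type*} [MeasurableSpace Ω] (P : Measure Ω) (α : ℝ)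
    (L : Lp ℝ 1 P) : EReal :=
  ((α⁻¹ : ℝ) : EReal) * extIntegral (Ioc 0 α) (fun u => expectile P u L)

/-- The explicit distortion function `φ` (used on `[0, 1]`). -/
noncomputable def distortion (α t : ℝ) : ℝ :=
  if t = 0 then 0
  else if t = 1 / 2 then 1 - α / 2
  else -(t / (1 - 2 * t)) *
    (1 - (1 - t) / (α * (1 - 2 * t)) * Real.log (1 - 2 * α + α / t))

/-- `R_φ(L) = ∫_0^1 φ'_+(t) q_t(L) dt`, where `φ'_+` is the right derivative of `φ`. -/
noncomputable def distortionRisk {Ω : Type*} [MeasurableSpace Ω] (P : Measure Ω) (φ : ℝ → ℝ)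
    (L : Lp ℝ 1 P) : EReal :=
  extIntegral (Ioo 0 1) (fun t => derivWithin φ (Ioi t) t * quantile P t L)

/-! ### Risk measures on `L¹` -/

/-- A coherent risk measure `R : L¹ → (-∞, ∞]`. -/
structure IsCoherent {Ω : Type*} [MeasurableSpace Ω] (P : Measure Ω) [IsProbabilityMeasure P]
    (R : Lp ℝ 1 P → EReal) : Prop where
  ne_bot : ∀ L, R L ≠ ⊥
  monotone : ∀ L₁ L₂, L₁ ≤ L₂ → R L₁ ≤ R L₂
  cash_invariant : ∀ L, ∀ m : ℝ, R (L - Lp.const 1 P m) = R L - (m : EReal)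
  subadditive : ∀ L₁ L₂, R (L₁ + L₂) ≤ R L₁ + R L₂
  pos_homogeneous : ∀ L, ∀ c : ℝ, 0 ≤ c → R (c • L) = (c : EReal) * R L

/-- Loss profiles with the same distribution have the same risk. -/
def IsLawInvariant {Ω : Type*} [MeasurableSpace Ω] (P : Measure Ω) (R : Lp ℝ 1 P → EReal) : Prop :=
  ∀ L₁ L₂ : Lp ℝ 1 P, P.map L₁ = P.map L₂ → R L₁ = R L₂

/-- Two elements of `L¹` are comonotone: they have versions that are comonotone functions. -/
def Comonotone {Ω : Type*} [MeasurableSpace Ω] (P : Measure Ω) (L₁ L₂ : Lp ℝ 1 P) : Prop :=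
  ∃ f g : Ω → ℝ, f =ᵐ[P] L₁ ∧ g =ᵐ[P] L₂ ∧ ∀ ω ω', 0 ≤ (f ω - f ω') * (g ω - g ω')

/-- `R` is additive on comonotone pairs. -/
def IsComonotonic {Ω : Type*} [MeasurableSpace Ω] (P : Measure Ω) (R : Lp ℝ 1 P → EReal) : Prop :=
  ∀ L₁ L₂ : Lp ℝ 1 P, Comonotone P L₁ L₂ → R (L₁ + L₂) = R L₁ + R L₂

end ExpectileRisk

namespace ExpectileRisk

/-! ### Integrals with values in `[-∞, ∞]` -/

/-! On an indicator of an event of probability `t` the first order condition is linear in `e` and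
gives `e_u = φ_u(t) = (1-u)t / (u + (1-2u)t)`, a concave distortion for `u ≤ 1/2`. Averaging over `u
∈ (0, α]` gives exactly `φ` (`distortion_eq_integral`). So `φ` is concave, `es_α(1_A) = φ(P[A])`,
and `φ'` is the average of the densities `φ_u'`.

Domination is proved level by level. With `e = e_u(X)` and `p = P[X > e]`, the first order condition
says that `q - e` integrates to zero against the step density equal to `(1-u)/D` on `(0, p)` and
`u/D` on `(p, 1)`, where `D = u + (1-2u)p`. The primitive of this density interpolates `φ_u`
linearly at `0, p, 1`, hence lies below the concave `φ_u`. As `q` is decreasing, passing to the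
density `φ_u'` can only increase the integral: `e_u(X) ≤ ∫ φ_u' q` (`expectile_le_integral`).
Tonelli's theorem in `u` gives `es_α ≤ R_φ`.

`R_φ` is additive on comonotone pairs because quantiles are. It is subadditive because every `∫_0^τ
q` is, and the decreasing weight `φ'` is a mixture of indicators of intervals `(0, τ)`.

For minimality, a competitor `R` satisfies `R(1_A) ≥ es_α(1_A) = R_φ(1_A)`. Staircase functions of
`L` are sums of comonotone multiples of indicators, so the inequality passes to them, and then to
nonnegative `L` by monotonicity of `R` and monotone convergence in `R_φ`. Cash invariance covers `L`
bounded below. In general `L = max(L, -k) + min(L + k, 0)` is a comonotone splitting, and `R` of the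
second term is at least its `es_α`, hence at least its mean, which tends to `0`. -/

/-- `∫ f⁺ - ∫ f⁻` as an extended real number. -/
noncomputable def extInt {β : Type*} [MeasurableSpace β] (μ : Measure β) (f : β → ℝ) : EReal :=
  ((∫⁻ x, ENNReal.ofReal (f x) ∂μ : ENNReal) : EReal) -
    ((∫⁻ x, ENNReal.ofReal (-f x) ∂μ : ENNReal) : EReal)

/-- Only the subtracted terms must be finite, so they can be moved across the inequality while `a`
and `c` may be infinite. Comparisons that are not pointwise are made in this cross form. -/
theorem coe_sub_le_coe_sub {a b c d : ENNReal} (hb : b ≠ ⊤) (hd : d ≠ ⊤) (h : a + d ≤ c + b) :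
    (a : EReal) - b ≤ c - d := by
  lift b to NNReal using hb
  lift d to NNReal using hd
  induction c with
  | top =>
    have : ((⊤ : ENNReal) : EReal) - ((d : ENNReal) : EReal) = ⊤ := by
      rw [EReal.coe_ennreal_top]; exact EReal.top_sub_coe _
    rw [this]; exact le_top
  | coe c =>
    have ha : a ≠ ⊤ := by
      rintro rfl
      simp at h
    lift a to NNReal using ha
    have h' : (a : ℝ) + d ≤ c + b := by exact_mod_cast h
    change (((a : ℝ) : EReal)) - ((b : ℝ) : EReal) ≤ ((c : ℝ) : EReal) - ((d : ℝ) : EReal)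
    rw [← EReal.coe_sub, ← EReal.coe_sub, EReal.coe_le_coe_iff]
    linarith

theorem coe_sub_eq_coe_sub {a b c d : ENNReal} (hb : b ≠ ⊤) (hd : d ≠ ⊤) (h : a + d = c + b) :
    (a : EReal) - b = c - d :=
  le_antisymm (coe_sub_le_coe_sub hb hd h.le) (coe_sub_le_coe_sub hd hb h.ge)

theorem coe_sub_add_coe_sub {a b c d : ENNReal} (hb : b ≠ ⊤) (hd : d ≠ ⊤) :
    ((a : EReal) - b) + ((c : EReal) - d) = ((a + c : ENNReal) : EReal) - ((b + d : ENNReal)) := by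
  lift b to NNReal using hb
  lift d to NNReal using hd
  have top_sub : ∀ x : NNReal, ((⊤ : ENNReal) : EReal) - ((x : ENNReal) : EReal) = ⊤ := fun x => by
    rw [EReal.coe_ennreal_top]; exact EReal.top_sub_coe _
  have hne : ∀ (x : ENNReal) (y : NNReal), (x : EReal) - ((y : ENNReal) : EReal) ≠ ⊥ := by
    intro x y
    induction x with
    | top => rw [top_sub]; exact top_ne_bot
    | coe x => exact EReal.coe_ne_bot ((x : ℝ) - (y : ℝ))
  rw [← ENNReal.coe_add]
  induction a with
  | top => rw [top_add, top_sub, top_sub, EReal.top_add_of_ne_bot (hne _ _)]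
  | coe a =>
    induction c with
    | top => rw [add_top, top_sub, top_sub, EReal.add_top_of_ne_bot (hne _ _)]
    | coe c =>
      rw [← ENNReal.coe_add]
      change (((a : ℝ) : EReal) - ((b : ℝ) : EReal)) + (((c : ℝ) : EReal) - ((d : ℝ) : EReal))
        = (((a + c : NNReal) : ℝ) : EReal) - (((b + d : NNReal) : ℝ) : EReal)
      rw [← EReal.coe_sub, ← EReal.coe_sub, ← EReal.coe_add, ← EReal.coe_sub]
      congr 1
      push_cast
      ring

theorem coe_mul_coe_sub {c : ℝ} (hc : 0 < c) {a b : ENNReal} (hb : b ≠ ⊤) :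
    (c : EReal) * ((a : EReal) - b) =
      ((ENNReal.ofReal c * a : ENNReal) : EReal) - ((ENNReal.ofReal c * b : ENNReal) : EReal) := by
  rw [EReal.coe_ennreal_mul, EReal.coe_ennreal_mul, EReal.coe_ennreal_ofReal, max_eq_left hc.le]
  lift b to NNReal using hb
  induction a with
  | top =>
    rw [EReal.coe_ennreal_top, EReal.coe_mul_top_of_pos hc]
    change (c : EReal) * (⊤ - ((b : ℝ) : EReal)) = (⊤ : EReal) - (c : EReal) * ((b : ℝ) : EReal)
    rw [← EReal.coe_mul, EReal.top_sub_coe, EReal.top_sub_coe, EReal.coe_mul_top_of_pos hc]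
  | coe a =>
    change (c : EReal) * (((a : ℝ) : EReal) - ((b : ℝ) : EReal)) =
      (c : EReal) * ((a : ℝ) : EReal) - (c : EReal) * ((b : ℝ) : EReal)
    norm_cast
    ring

theorem coe_sub_ne_bot {a b : ENNReal} (hb : b ≠ ⊤) : (a : EReal) - b ≠ ⊥ := by
  lift b to NNReal using hb
  induction a with
  | top =>
    rw [EReal.coe_ennreal_top]
    exact (EReal.top_sub_coe (b : ℝ)).trans_ne top_ne_bot
  | coe x => exact EReal.coe_ne_bot ((x : ℝ) - (b : ℝ))

section ExtInt

variable {β : Type*} [MeasurableSpace β] {μ : Measure β} {f g : β → ℝ}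

theorem extInt_ne_bot (hf : ∫⁻ x, ENNReal.ofReal (-f x) ∂μ ≠ ⊤) : extInt μ f ≠ ⊥ :=
  coe_sub_ne_bot hf

theorem extInt_mono_ae (h : f ≤ᵐ[μ] g) : extInt μ f ≤ extInt μ g := by
  refine EReal.sub_le_sub ?_ ?_ <;> rw [EReal.coe_ennreal_le_coe_ennreal_iff]
  · exact lintegral_mono_ae (h.mono fun x hx => ENNReal.ofReal_le_ofReal hx)
  · exact lintegral_mono_ae (h.mono fun x hx => ENNReal.ofReal_le_ofReal (neg_le_neg hx))

theorem extInt_congr_ae (h : f =ᵐ[μ] g) : extInt μ f = extInt μ g :=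
  le_antisymm (extInt_mono_ae h.le) (extInt_mono_ae h.symm.le)

/-- This is `(x+y)⁺ - (x+y)⁻ = x⁺ - x⁻ + y⁺ - y⁻` rearranged so that nothing is subtracted. -/
theorem ofReal_add_cross (x y : ℝ) :
    ENNReal.ofReal (x + y) + (ENNReal.ofReal (-x) + ENNReal.ofReal (-y)) =
      (ENNReal.ofReal x + ENNReal.ofReal y) + ENNReal.ofReal (-(x + y)) := by
  have key : ∀ z : ℝ, ENNReal.ofReal z = ENNReal.ofReal (max z 0) := fun z => by
    rcases le_total z 0 with hz | hz
    · rw [max_eq_right hz, ENNReal.ofReal_of_nonpos hz, ENNReal.ofReal_zero]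
    · rw [max_eq_left hz]
  rw [key (x + y), key (-x), key (-y), key x, key y, key (-(x + y)),
    ← ENNReal.ofReal_add (by positivity) (by positivity),
    ← ENNReal.ofReal_add (by positivity) (by positivity),
    ← ENNReal.ofReal_add (by positivity) (by positivity),
    ← ENNReal.ofReal_add (by positivity) (by positivity)]
  congr 1
  have h := fun z : ℝ => max_zero_sub_max_neg_zero_eq_self z
  linarith [h x, h y, h (x + y)]

theorem extInt_add (hf : AEMeasurable f μ) (hg : AEMeasurable g μ)
    (hf' : ∫⁻ x, ENNReal.ofReal (-f x) ∂μ ≠ ⊤) (hg' : ∫⁻ x, ENNReal.ofReal (-g x) ∂μ ≠ ⊤) :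
    extInt μ (fun x => f x + g x) = extInt μ f + extInt μ g := by
  have hfn : AEMeasurable (fun x => ENNReal.ofReal (-f x)) μ := hf.neg.ennreal_ofReal
  have hgn : AEMeasurable (fun x => ENNReal.ofReal (-g x)) μ := hg.neg.ennreal_ofReal
  have hfg : AEMeasurable (fun x => ENNReal.ofReal (f x + g x)) μ := (hf.add hg).ennreal_ofReal
  rw [extInt, extInt, extInt, coe_sub_add_coe_sub hf' hg',
    ← lintegral_add_left' hf.ennreal_ofReal, ← lintegral_add_left' hfn]
  have hs : ∫⁻ x, (ENNReal.ofReal (-f x) + ENNReal.ofReal (-g x)) ∂μ ≠ ⊤ := by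
    rw [lintegral_add_left' hfn]
    exact ENNReal.add_ne_top.2 ⟨hf', hg'⟩
  refine coe_sub_eq_coe_sub (ne_top_of_le_ne_top hs (lintegral_mono fun x => ?_)) hs ?_
  · rw [neg_add]; exact ENNReal.ofReal_add_le
  · rw [← lintegral_add_left' hfg]
    refine Eq.trans ?_ (lintegral_add_left' (hf.ennreal_ofReal.add hg.ennreal_ofReal) _)
    exact lintegral_congr fun x => ofReal_add_cross _ _

theorem extInt_const [IsProbabilityMeasure μ] (c : ℝ) : extInt μ (fun _ => c) = c := by
  rw [extInt, lintegral_const, lintegral_const, measure_univ, mul_one, mul_one]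
  rw [EReal.coe_ennreal_ofReal, EReal.coe_ennreal_ofReal, ← EReal.coe_sub]
  rw [max_zero_sub_max_neg_zero_eq_self]

theorem extInt_const_mul {c : ℝ} (hc : 0 ≤ c) (hf' : ∫⁻ x, ENNReal.ofReal (-f x) ∂μ ≠ ⊤) :
    extInt μ (fun x => c * f x) = c * extInt μ f := by
  rcases hc.eq_or_lt with rfl | hc'
  · simp [extInt]
  rw [extInt, extInt, coe_mul_coe_sub hc' hf', ← lintegral_const_mul' _ _ ENNReal.ofReal_ne_top,
    ← lintegral_const_mul' _ _ ENNReal.ofReal_ne_top]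
  simp only [← ENNReal.ofReal_mul hc, mul_neg]

theorem extInt_smul_measure {c : ℝ} (hc : 0 < c) (hf' : ∫⁻ x, ENNReal.ofReal (-f x) ∂μ ≠ ⊤) :
    extInt (ENNReal.ofReal c • μ) f = c * extInt μ f := by
  rw [extInt, extInt, coe_mul_coe_sub hc hf', lintegral_smul_measure, lintegral_smul_measure]
  rfl

/-- Comparison of extended integrals through a cross inequality of nonnegative integrals. -/
theorem extInt_le_extInt (hf' : ∫⁻ x, ENNReal.ofReal (-f x) ∂μ ≠ ⊤)
    (hg' : ∫⁻ x, ENNReal.ofReal (-g x) ∂μ ≠ ⊤)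
    (h : ∫⁻ x, ENNReal.ofReal (f x) ∂μ + ∫⁻ x, ENNReal.ofReal (-g x) ∂μ ≤
      ∫⁻ x, ENNReal.ofReal (g x) ∂μ + ∫⁻ x, ENNReal.ofReal (-f x) ∂μ) :
    extInt μ f ≤ extInt μ g :=
  coe_sub_le_coe_sub hf' hg' h

theorem lintegral_ofReal_ne_top (hf : Integrable f μ) :
    ∫⁻ x, ENNReal.ofReal (f x) ∂μ ≠ ⊤ :=
  ne_top_of_le_ne_top hf.hasFiniteIntegral.ne
    (lintegral_mono fun _ => Real.ofReal_le_enorm _)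

/-- For integrable functions, an inequality of integrals in cross form. -/
theorem lintegral_cross_le (hf : Integrable f μ) (hg : Integrable g μ)
    (h : ∫ x, f x ∂μ ≤ ∫ x, g x ∂μ) :
    ∫⁻ x, (ENNReal.ofReal (f x) + ENNReal.ofReal (-g x)) ∂μ ≤
      ∫⁻ x, (ENNReal.ofReal (g x) + ENNReal.ofReal (-f x)) ∂μ := by
  rw [lintegral_add_left' hf.aemeasurable.ennreal_ofReal,
    lintegral_add_left' hg.aemeasurable.ennreal_ofReal]
  rw [integral_eq_lintegral_pos_part_sub_lintegral_neg_part hf,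
    integral_eq_lintegral_pos_part_sub_lintegral_neg_part hg] at h
  have h1 := lintegral_ofReal_ne_top hf
  have h2 := lintegral_ofReal_ne_top hf.neg
  have h3 := lintegral_ofReal_ne_top hg
  have h4 := lintegral_ofReal_ne_top hg.neg
  simp only [Pi.neg_apply] at h2 h4
  rw [← ENNReal.toReal_le_toReal (ENNReal.add_ne_top.2 ⟨h1, h4⟩) (ENNReal.add_ne_top.2 ⟨h3, h2⟩),
    ENNReal.toReal_add h1 h4, ENNReal.toReal_add h3 h2]
  linarith

end ExtInt

/-! ### Comparison of integrals with monotone weights -/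

/-- Layer cake: `w` is the integral over `s > 0` of the indicators of `{s < w}`, so comparing the
two measures on superlevel sets suffices. -/
theorem lintegral_weight_mono {β : Type*} [MeasurableSpace β] {μ : Measure β} {w : β → ℝ}
    {f g : β → ENNReal} (hw : AEMeasurable w μ) (hw0 : ∀ᵐ x ∂μ, 0 ≤ w x) (hf : AEMeasurable f μ)
    (hg : AEMeasurable g μ)
    (h : ∀ s : ℝ, 0 < s → μ.withDensity f {x | s < w x} ≤ μ.withDensity g {x | s < w x}) :
    ∫⁻ x, ENNReal.ofReal (w x) * f x ∂μ ≤ ∫⁻ x, ENNReal.ofReal (w x) * g x ∂μ := by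
  have key : ∀ k : β → ENNReal, AEMeasurable k μ → ∫⁻ x, ENNReal.ofReal (w x) * k x ∂μ =
      ∫⁻ s in Ioi (0 : ℝ), μ.withDensity k {x | s < w x} := by
    intro k hk
    rw [← lintegral_eq_lintegral_meas_lt (μ.withDensity k)
      ((withDensity_absolutelyContinuous μ k).ae_le hw0)
      (hw.mono_ac (withDensity_absolutelyContinuous μ k)),
      lintegral_withDensity_eq_lintegral_mul₀ hk hw.ennreal_ofReal]
    exact lintegral_congr fun x => mul_comm _ _
  rw [key f hf, key g hg]
  exact setLIntegral_mono' measurableSet_Ioi fun s hs => h s hs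

/-- A lower set of an open interval is, up to one point, an open interval. -/
theorem exists_cut_of_lower {a b : ℝ} (hab : a ≤ b) {T : Set ℝ}
    (hT : ∀ x ∈ Ioo a b, ∀ y ∈ Ioo a b, x ≤ y → y ∈ T → x ∈ T) :
    ∃ τ ∈ Icc a b, ∀ x ∈ Ioo a b, (x < τ → x ∈ T) ∧ (τ < x → x ∉ T) := by
  set A : Set ℝ := insert a (T ∩ Ioo a b)
  have hA : BddAbove A := ⟨b, by
    rintro x (rfl | hx)
    · exact hab
    · exact hx.2.2.le⟩
  have hne : A.Nonempty := ⟨a, Or.inl rfl⟩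
  refine ⟨sSup A, ⟨le_csSup hA (Or.inl rfl), csSup_le hne ?_⟩, fun x hx => ⟨fun h => ?_, fun h hx' => ?_⟩⟩
  · rintro x (rfl | hx)
    · exact hab
    · exact hx.2.2.le
  · obtain ⟨y, hy, hxy⟩ := exists_lt_of_lt_csSup hne h
    rcases hy with rfl | hy
    · exact absurd hx.1 (not_lt.2 hxy.le)
    · exact hT x hx y hy.2 hxy.le hy.1
  · exact absurd (le_csSup hA (Or.inr ⟨hx', hx⟩)) (not_le.2 h)

/-- Whether the cut point belongs to a level set of a monotone weight is unknown, and irrelevant,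
since a point is null. -/
theorem withDensity_eq_setLIntegral_of_ae {a b c d : ℝ} {f : ℝ → ENNReal} {T : Set ℝ} (τ : ℝ)
    (hcd : Ioo c d ⊆ Ioo a b)
    (hT : ∀ x ∈ Ioo a b, x ≠ τ → (x ∈ T ↔ x ∈ Ioo c d)) :
    (volume.restrict (Ioo a b)).withDensity f T = ∫⁻ x in Ioo c d, f x := by
  have h1 : T =ᵐ[volume.restrict (Ioo a b)] Ioo c d := by
    have : ∀ᵐ x ∂(volume : Measure ℝ), x ≠ τ := by
      simp [ae_iff]
    filter_upwards [ae_restrict_mem measurableSet_Ioo, ae_restrict_of_ae this] with x hx hx'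
    exact propext (hT x hx hx')
  rw [measure_congr ((withDensity_absolutelyContinuous _ f).ae_le h1),
    withDensity_apply _ measurableSet_Ioo, Measure.restrict_restrict measurableSet_Ioo,
    inter_eq_left.2 hcd]

/-- The superlevel sets of a decreasing weight are initial intervals up to one point, so ordered
partial integrals from the left are enough. -/
theorem lintegral_antitone_weight_mono {a b : ℝ} (hab : a ≤ b) {w : ℝ → ℝ} {f g : ℝ → ENNReal}
    (hw : AntitoneOn w (Ioo a b)) (hw0 : ∀ x ∈ Ioo a b, 0 ≤ w x)
    (hf : AEMeasurable f (volume.restrict (Ioo a b)))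
    (hg : AEMeasurable g (volume.restrict (Ioo a b)))
    (h : ∀ τ ∈ Icc a b, ∫⁻ x in Ioo a τ, f x ≤ ∫⁻ x in Ioo a τ, g x) :
    ∫⁻ x in Ioo a b, ENNReal.ofReal (w x) * f x ≤ ∫⁻ x in Ioo a b, ENNReal.ofReal (w x) * g x := by
  refine lintegral_weight_mono (aemeasurable_restrict_of_antitoneOn measurableSet_Ioo hw)
    ((ae_restrict_iff' measurableSet_Ioo).2 (ae_of_all _ hw0)) hf hg fun s _ => ?_
  obtain ⟨τ, hτ, hτ'⟩ := exists_cut_of_lower hab (T := {x | s < w x})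
    fun x hx y hy hxy (hs : s < w y) => hs.trans_le (hw hx hy hxy)
  have e : ∀ x ∈ Ioo a b, x ≠ τ → (x ∈ {x | s < w x} ↔ x ∈ Ioo a τ) := by
    intro x hx hne
    rcases lt_or_gt_of_ne hne with hlt | hgt
    · exact ⟨fun _ => ⟨hx.1, hlt⟩, fun _ => (hτ' x hx).1 hlt⟩
    · exact ⟨fun h => absurd h ((hτ' x hx).2 hgt), fun h => absurd h.2 (not_lt.2 hgt.le)⟩
  rw [withDensity_eq_setLIntegral_of_ae τ (Ioo_subset_Ioo_right hτ.2) e,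
    withDensity_eq_setLIntegral_of_ae τ (Ioo_subset_Ioo_right hτ.2) e]
  exact h τ hτ

theorem lintegral_monotone_weight_mono {a b : ℝ} (hab : a ≤ b) {w : ℝ → ℝ} {f g : ℝ → ENNReal}
    (hw : MonotoneOn w (Ioo a b)) (hw0 : ∀ x ∈ Ioo a b, 0 ≤ w x)
    (hf : AEMeasurable f (volume.restrict (Ioo a b)))
    (hg : AEMeasurable g (volume.restrict (Ioo a b)))
    (h : ∀ τ ∈ Icc a b, ∫⁻ x in Ioo τ b, f x ≤ ∫⁻ x in Ioo τ b, g x) :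
    ∫⁻ x in Ioo a b, ENNReal.ofReal (w x) * f x ≤ ∫⁻ x in Ioo a b, ENNReal.ofReal (w x) * g x := by
  refine lintegral_weight_mono (aemeasurable_restrict_of_monotoneOn measurableSet_Ioo hw)
    ((ae_restrict_iff' measurableSet_Ioo).2 (ae_of_all _ hw0)) hf hg fun s _ => ?_
  -- For an increasing weight the lower sets are the sublevel sets, so the cut is taken there and
  -- the superlevel sets are final intervals.
  obtain ⟨τ, hτ, hτ'⟩ := exists_cut_of_lower hab (T := {x | w x ≤ s})
    fun x hx y hy hxy (hs : w y ≤ s) => (hw hx hy hxy).trans hs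
  have e : ∀ x ∈ Ioo a b, x ≠ τ → (x ∈ {x | s < w x} ↔ x ∈ Ioo τ b) := by
    intro x hx hne
    rcases lt_or_gt_of_ne hne with hlt | hgt
    · have : w x ≤ s := (hτ' x hx).1 hlt
      exact ⟨fun h => absurd h (not_lt.2 this), fun h => absurd h.1 (not_lt.2 hlt.le)⟩
    · have : ¬ w x ≤ s := (hτ' x hx).2 hgt
      exact ⟨fun _ => ⟨hgt, hx.2⟩, fun _ => not_le.1 this⟩
  rw [withDensity_eq_setLIntegral_of_ae τ (Ioo_subset_Ioo_left hτ.1) e,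
    withDensity_eq_setLIntegral_of_ae τ (Ioo_subset_Ioo_left hτ.1) e]
  exact h τ hτ

/-! ### Quantiles -/

section Quantile

open ProbabilityTheory Filter Topology

variable {Ω : Type*} [MeasurableSpace Ω] {P : Measure Ω} {X Y : Ω → ℝ} {t : ℝ}

theorem measureReal_le_congr (h : X =ᵐ[P] Y) (m : ℝ) :
    P.real {ω | X ω ≤ m} = P.real {ω | Y ω ≤ m} := by
  refine measureReal_congr (h.mono fun ω hω => ?_)
  change (X ω ≤ m) = (Y ω ≤ m)
  rw [hω]

theorem quantile_congr_ae (h : X =ᵐ[P] Y) (t : ℝ) : quantile P t X = quantile P t Y := by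
  simp only [quantile, measureReal_le_congr h]

theorem quantile_eq_of_map_eq (hX : AEMeasurable X P) (hY : AEMeasurable Y P)
    (h : P.map X = P.map Y) (t : ℝ) : quantile P t X = quantile P t Y := by
  have : ∀ m : ℝ, P.real {ω | X ω ≤ m} = P.real {ω | Y ω ≤ m} := by
    intro m
    have := congrArg (fun μ : Measure ℝ => μ.real (Iic m)) h
    simp only [map_measureReal_apply_of_aemeasurable hX measurableSet_Iic,
      map_measureReal_apply_of_aemeasurable hY measurableSet_Iic] at this
    exact this
  simp only [quantile, this]

variable [IsProbabilityMeasure P]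

/-- The infimum is attained because the distribution function is right continuous; `0 < t < 1` makes
the set nonempty and bounded below. This Galois connection replaces the definition in most of what
follows. -/
theorem quantile_le_iff (hX : AEMeasurable X P) (ht : t ∈ Ioo (0 : ℝ) 1) {m : ℝ} :
    quantile P t X ≤ m ↔ 1 - t ≤ P.real {ω | X ω ≤ m} := by
  have := Measure.isProbabilityMeasure_map hX
  have hF : ∀ m : ℝ, P.real {ω | X ω ≤ m} = cdf (P.map X) m := fun m => by
    rw [cdf_eq_real, map_measureReal_apply_of_aemeasurable hX measurableSet_Iic]; rfl
  have hne : {m : ℝ | 1 - t ≤ cdf (P.map X) m}.Nonempty := by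
    obtain ⟨m, hm⟩ := ((tendsto_cdf_atTop (P.map X)).eventually
      (lt_mem_nhds (show 1 - t < 1 by linarith [ht.1]))).exists
    exact ⟨m, hm.le⟩
  have hbdd : BddBelow {m : ℝ | 1 - t ≤ cdf (P.map X) m} := by
    obtain ⟨b, hb⟩ := eventually_atBot.1 ((tendsto_cdf_atBot (P.map X)).eventually
      (gt_mem_nhds (show 0 < 1 - t by linarith [ht.2])))
    exact ⟨b, fun m hm => le_of_not_gt fun h => absurd (hb m h.le) (not_lt.2 hm)⟩
  simp only [quantile, hF]
  refine ⟨fun h => ?_, fun h => csInf_le hbdd h⟩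
  refine le_trans ?_ (monotone_cdf _ h)
  have hc : Tendsto (cdf (P.map X)) (𝓝[>] sInf {m : ℝ | 1 - t ≤ cdf (P.map X) m})
      (𝓝 (cdf (P.map X) (sInf {m : ℝ | 1 - t ≤ cdf (P.map X) m}))) :=
    ((cdf (P.map X)).right_continuous _).mono_left (nhdsWithin_mono _ Ioi_subset_Ici_self)
  refine ge_of_tendsto hc ?_
  filter_upwards [self_mem_nhdsWithin] with x hx
  obtain ⟨y, hy, hyx⟩ := exists_lt_of_csInf_lt hne hx
  exact le_trans hy (monotone_cdf _ hyx.le)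

theorem lt_quantile_iff (hX : AEMeasurable X P) (ht : t ∈ Ioo (0 : ℝ) 1) {m : ℝ} :
    m < quantile P t X ↔ P.real {ω | X ω ≤ m} < 1 - t := by
  rw [← not_le, quantile_le_iff hX ht, not_le]

theorem quantile_antitoneOn (hX : AEMeasurable X P) :
    AntitoneOn (fun t => quantile P t X) (Ioo 0 1) := fun s hs t ht hst =>
  (quantile_le_iff hX ht).2
    (le_trans (by linarith) ((quantile_le_iff hX hs).1 (le_refl (quantile P s X))))

theorem aemeasurable_quantile (hX : AEMeasurable X P) :
    AEMeasurable (fun t => quantile P t X) (volume.restrict (Ioo (0 : ℝ) 1)) :=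
  aemeasurable_restrict_of_antitoneOn measurableSet_Ioo (quantile_antitoneOn hX)

theorem quantile_mono (hX : AEMeasurable X P) (hY : AEMeasurable Y P) (h : X ≤ᵐ[P] Y)
    (ht : t ∈ Ioo (0 : ℝ) 1) : quantile P t X ≤ quantile P t Y := by
  rw [quantile_le_iff hX ht]
  refine ((quantile_le_iff hY ht).1 le_rfl).trans ?_
  exact ENNReal.toReal_mono (measure_ne_top _ _)
    (measure_mono_ae (h.mono fun ω hω (hY : Y ω ≤ _) => hω.trans hY))

theorem quantile_add_const (hX : AEMeasurable X P) (c : ℝ) (ht : t ∈ Ioo (0 : ℝ) 1) :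
    quantile P t (fun ω => X ω + c) = quantile P t X + c := by
  refine eq_of_forall_ge_iff fun m => ?_
  rw [quantile_le_iff (hX.add_const c) ht, ← le_sub_iff_add_le, quantile_le_iff hX ht]
  simp only [le_sub_iff_add_le]

theorem quantile_const (c : ℝ) (ht : t ∈ Ioo (0 : ℝ) 1) :
    quantile P t (fun _ => c) = c := by
  refine eq_of_forall_ge_iff fun m => ?_
  rw [quantile_le_iff aemeasurable_const ht]
  by_cases h : c ≤ m
  · simpa [h] using ht.1.le
  · simpa [h] using ht.2

theorem quantile_const_mul (hX : AEMeasurable X P) {c : ℝ} (hc : 0 ≤ c) (ht : t ∈ Ioo (0 : ℝ) 1) :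
    quantile P t (fun ω => c * X ω) = c * quantile P t X := by
  rcases hc.eq_or_lt with rfl | hc
  · simpa using quantile_const 0 ht
  refine eq_of_forall_ge_iff fun m => ?_
  rw [quantile_le_iff (hX.const_mul c) ht, ← le_div_iff₀' hc, quantile_le_iff hX ht]
  simp only [le_div_iff₀' hc]

theorem quantile_min_const (hX : AEMeasurable X P) (c : ℝ) (ht : t ∈ Ioo (0 : ℝ) 1) :
    quantile P t (fun ω => min (X ω) c) = min (quantile P t X) c := by
  refine eq_of_forall_ge_iff fun m => ?_
  rw [quantile_le_iff (hX.min aemeasurable_const) ht, min_le_iff, quantile_le_iff hX ht]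
  by_cases h : c ≤ m
  · simpa [h] using ht.1.le
  · simp [h]

theorem quantile_indicator {A : Set Ω} (hA : MeasurableSet A) (ht : t ∈ Ioo (0 : ℝ) 1) :
    quantile P t (A.indicator fun _ => (1 : ℝ)) = if t < P.real A then 1 else 0 := by
  have hm : AEMeasurable (A.indicator fun _ => (1 : ℝ)) P :=
    (measurable_const.indicator hA).aemeasurable
  refine eq_of_forall_ge_iff fun m => ?_
  rw [quantile_le_iff hm ht]
  have hle : ∀ ω, A.indicator (fun _ => (1 : ℝ)) ω ≤ 1 := fun ω =>
    indicator_le' (fun _ _ => le_rfl) (fun _ _ => zero_le_one) ω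
  have hge : ∀ ω, 0 ≤ A.indicator (fun _ => (1 : ℝ)) ω := fun ω =>
    indicator_nonneg (fun _ _ => zero_le_one) ω
  rcases le_or_gt 1 m with h1 | h1
  · have : {ω | A.indicator (fun _ => (1 : ℝ)) ω ≤ m} = univ :=
      eq_univ_of_forall fun ω => (hle ω).trans h1
    rw [this, probReal_univ]
    refine iff_of_true (by linarith [ht.1]) ?_
    split_ifs <;> linarith
  rcases lt_or_ge m 0 with h0 | h0
  · have : {ω | A.indicator (fun _ => (1 : ℝ)) ω ≤ m} = ∅ :=
      eq_empty_of_forall_notMem fun ω h => absurd (hge ω) (not_le.2 (lt_of_le_of_lt h h0))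
    rw [this, measureReal_empty]
    refine iff_of_false (by linarith [ht.2]) ?_
    split_ifs <;> linarith
  · have : {ω | A.indicator (fun _ => (1 : ℝ)) ω ≤ m} = Aᶜ := by
      ext ω
      by_cases hω : ω ∈ A
      · simpa [hω] using h1
      · simpa [hω] using h0
    rw [this, probReal_compl_eq_one_sub hA]
    split_ifs with h
    · exact iff_of_false (by linarith) (by linarith)
    · exact iff_of_true (by linarith) h0

/-- Quantiles are additive on comonotone pairs. -/
theorem quantile_add_of_comonotone {f g : Ω → ℝ} (hf : AEMeasurable f P) (hg : AEMeasurable g P)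
    (h : ∀ ω ω', 0 ≤ (f ω - f ω') * (g ω - g ω')) (ht : t ∈ Ioo (0 : ℝ) 1) :
    quantile P t (fun ω => f ω + g ω) = quantile P t f + quantile P t g := by
  -- Sublevel sets of comonotone functions form a chain, so the probability of an intersection or a
  -- union of two of them is that of one of the two.
  have nested : ∀ x y : ℝ, {ω | f ω ≤ x} ⊆ {ω | g ω ≤ y} ∨ {ω | g ω ≤ y} ⊆ {ω | f ω ≤ x} := by
    intro x y
    by_contra! hcon
    obtain ⟨⟨ω, hω, hω'⟩, ⟨η, hη, hη'⟩⟩ := And.imp not_subset.1 not_subset.1 hcon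
    simp only [mem_ofPred_eq, not_le] at hω hω' hη hη'
    have := h ω η
    nlinarith [mul_pos (show 0 < f η - f ω by linarith) (show 0 < g ω - g η by linarith)]
  have hfg : AEMeasurable (fun ω => f ω + g ω) P := hf.add hg
  apply le_antisymm
  · rw [quantile_le_iff hfg ht]
    have h1 := (quantile_le_iff hf ht).1 le_rfl
    have h2 := (quantile_le_iff hg ht).1 le_rfl
    rcases nested (quantile P t f) (quantile P t g) with hs | hs
    · exact h1.trans (measureReal_mono fun ω hω =>
        show f ω + g ω ≤ _ from add_le_add hω (hs hω))
    · exact h2.trans (measureReal_mono fun ω hω =>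
        show f ω + g ω ≤ _ from add_le_add (hs hω) hω)
  -- Strictly below the quantiles both sublevel sets have probability less than `1 - t`, and by
  -- nestedness so has their union.
  · refine le_of_forall_pos_le_add fun ε hε => ?_
    have h1 := (lt_quantile_iff hf ht).1 (show quantile P t f - ε / 2 < _ by linarith)
    have h2 := (lt_quantile_iff hg ht).1 (show quantile P t g - ε / 2 < _ by linarith)
    have hsub : {ω | f ω + g ω ≤ (quantile P t f - ε / 2) + (quantile P t g - ε / 2)} ⊆
        {ω | f ω ≤ quantile P t f - ε / 2} ∪ {ω | g ω ≤ quantile P t g - ε / 2} := by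
      intro ω hω
      by_contra hcon
      simp only [mem_union, mem_ofPred_eq, not_or, not_le] at hcon hω
      linarith [hcon.1, hcon.2]
    have h3 : (quantile P t f - ε / 2) + (quantile P t g - ε / 2) <
        quantile P t (fun ω => f ω + g ω) := by
      rw [lt_quantile_iff hfg ht]
      rcases nested (quantile P t f - ε / 2) (quantile P t g - ε / 2) with hs | hs
      · rw [union_eq_self_of_subset_left hs] at hsub
        exact (measureReal_mono hsub).trans_lt h2
      · rw [union_eq_self_of_subset_right hs] at hsub
        exact (measureReal_mono hsub).trans_lt h1
    linarith

/-- Under Lebesgue measure on `(0, 1)` the quantile function has the distribution of `X`. -/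
theorem map_quantile (hX : AEMeasurable X P) :
    (volume.restrict (Ioo (0 : ℝ) 1)).map (fun t => quantile P t X) = P.map X := by
  have := Measure.isProbabilityMeasure_map hX
  symm
  refine Measure.ext_of_Iic _ _ fun m => ?_
  rw [Measure.map_apply_of_aemeasurable (aemeasurable_quantile hX) measurableSet_Iic,
    Measure.map_apply_of_aemeasurable hX measurableSet_Iic]
  have e : (fun t => quantile P t X) ⁻¹' Iic m =ᵐ[volume.restrict (Ioo (0 : ℝ) 1)]
      Ici (1 - P.real (X ⁻¹' Iic m)) := by
    filter_upwards [ae_restrict_mem measurableSet_Ioo] with t ht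
    refine propext ((quantile_le_iff hX ht).trans ?_)
    change 1 - t ≤ P.real (X ⁻¹' Iic m) ↔ 1 - P.real (X ⁻¹' Iic m) ≤ t
    constructor <;> intro h <;> linarith
  rw [measure_congr e, Measure.restrict_apply measurableSet_Ici]
  have hp0 : 0 ≤ P.real (X ⁻¹' Iic m) := measureReal_nonneg
  have hp1 : P.real (X ⁻¹' Iic m) ≤ 1 := measureReal_le_one
  have e2 : (Ici (1 - P.real (X ⁻¹' Iic m)) ∩ Ioo (0 : ℝ) 1 : Set ℝ) =ᵐ[volume]
      Ioo (1 - P.real (X ⁻¹' Iic m)) 1 := by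
    have : ∀ᵐ x ∂(volume : Measure ℝ), x ≠ 1 - P.real (X ⁻¹' Iic m) := by simp [ae_iff]
    filter_upwards [this] with x hx
    refine propext ⟨fun h => ⟨lt_of_le_of_ne h.1 hx.symm, h.2.2⟩, fun h => ⟨h.1.le, ?_, h.2⟩⟩
    exact lt_of_le_of_lt (by linarith) h.1
  rw [measure_congr e2, Real.volume_Ioo, sub_sub_cancel, ofReal_measureReal]

theorem lintegral_quantile (hX : AEMeasurable X P) {k : ℝ → ENNReal} (hk : Measurable k) :
    ∫⁻ t in Ioo (0 : ℝ) 1, k (quantile P t X) = ∫⁻ ω, k (X ω) ∂P := by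
  rw [← lintegral_map' hk.aemeasurable (aemeasurable_quantile hX), map_quantile hX,
    lintegral_map' hk.aemeasurable hX]

theorem integrableOn_quantile (hX : Integrable X P) :
    IntegrableOn (fun t => quantile P t X) (Ioo 0 1) := by
  refine ⟨(aemeasurable_quantile hX.aemeasurable).aestronglyMeasurable, ?_⟩
  rw [HasFiniteIntegral, lintegral_quantile hX.aemeasurable measurable_enorm]
  exact hX.hasFiniteIntegral

theorem integral_quantile (hX : AEMeasurable X P) :
    ∫ t in Ioo (0 : ℝ) 1, quantile P t X = ∫ ω, X ω ∂P := by
  have h := integral_map (μ := volume.restrict (Ioo (0 : ℝ) 1)) (aemeasurable_quantile hX)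
    (f := fun x : ℝ => x) measurable_id.aestronglyMeasurable
  have h' := integral_map (f := fun x : ℝ => x) hX measurable_id.aestronglyMeasurable
  rw [← h, map_quantile hX, h']

theorem integral_max_quantile_sub (hX : AEMeasurable X P) (m : ℝ) :
    ∫ t in Ioo (0 : ℝ) 1, max (quantile P t X - m) 0 = ∫ ω, max (X ω - m) 0 ∂P := by
  have hk : AEStronglyMeasurable (fun x : ℝ => max (x - m) 0)
      ((volume.restrict (Ioo (0 : ℝ) 1)).map (fun t => quantile P t X)) :=
    (by fun_prop : Measurable fun x : ℝ => max (x - m) 0).aestronglyMeasurable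
  have h := integral_map (aemeasurable_quantile hX) hk
  rw [← h, map_quantile hX, integral_map hX
    (by fun_prop : Measurable fun x : ℝ => max (x - m) 0).aestronglyMeasurable]

theorem integrable_max_sub (hX : Integrable X P) (m : ℝ) :
    Integrable (fun ω => max (X ω - m) 0) P :=
  (hX.sub (integrable_const m)).pos_part

theorem integrableOn_max_quantile_sub (hX : Integrable X P) (m : ℝ) :
    IntegrableOn (fun t => max (quantile P t X - m) 0) (Ioo 0 1) :=
  ((integrableOn_quantile hX).sub (integrable_const m)).pos_part

/-- Rockafellar–Uryasev bound: `q ≤ m + (q - m)⁺` on `(0, τ)`, and the positive part is then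
integrated over all of `(0, 1)`. -/
theorem setIntegral_quantile_le (hX : Integrable X P) {τ : ℝ} (hτ : τ ∈ Icc (0 : ℝ) 1) (m : ℝ) :
    ∫ t in Ioo 0 τ, quantile P t X ≤ τ * m + ∫ ω, max (X ω - m) 0 ∂P := by
  have hsub : Ioo 0 τ ⊆ Ioo (0 : ℝ) 1 := Ioo_subset_Ioo_right hτ.2
  have hq := (integrableOn_quantile hX).mono_set hsub
  have hmax := integrableOn_max_quantile_sub hX m
  have hc : ∫ _ in Ioo 0 τ, m = τ * m := by simp [hτ.1]
  rw [← integral_max_quantile_sub hX.aemeasurable, ← hc]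
  calc ∫ t in Ioo 0 τ, quantile P t X
      ≤ ∫ t in Ioo 0 τ, (m + max (quantile P t X - m) 0) := by
        refine integral_mono hq ((integrable_const m).add (hmax.mono_set hsub)) fun t => ?_
        simp only
        linarith [le_max_left (quantile P t X - m) 0]
    _ = (∫ _ in Ioo 0 τ, m) + ∫ t in Ioo 0 τ, max (quantile P t X - m) 0 :=
        integral_add (integrable_const m) (hmax.mono_set hsub)
    _ ≤ _ := by
        exact add_le_add le_rfl (setIntegral_mono_set hmax
          (ae_of_all _ fun t => le_max_right (quantile P t X - m) 0) hsub.eventuallyLE)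

/-- The bound of `setIntegral_quantile_le` is attained at `m = q_τ`, since `q ≥ m` before `τ` and `q
≤ m` after it. -/
theorem setIntegral_quantile_eq (hX : Integrable X P) {τ : ℝ} (hτ : τ ∈ Ioo (0 : ℝ) 1) :
    ∫ t in Ioo 0 τ, quantile P t X =
      τ * quantile P τ X + ∫ ω, max (X ω - quantile P τ X) 0 ∂P := by
  have hsub : Ioo 0 τ ⊆ Ioo (0 : ℝ) 1 := Ioo_subset_Ioo_right hτ.2.le
  set m := quantile P τ X with hm
  have hmax := integrableOn_max_quantile_sub hX m
  have hc : ∫ _ in Ioo 0 τ, m = τ * m := by simp [hτ.1.le]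
  rw [← integral_max_quantile_sub hX.aemeasurable, ← hc]
  have h1 : ∫ t in Ioo (0 : ℝ) 1, max (quantile P t X - m) 0 =
      ∫ t in Ioo 0 τ, max (quantile P t X - m) 0 := by
    refine setIntegral_eq_of_subset_of_forall_sdiff_eq_zero measurableSet_Ioo hsub fun t ht => ?_
    have : τ ≤ t := not_lt.1 fun h => ht.2 ⟨ht.1.1, h⟩
    have := quantile_antitoneOn hX.aemeasurable hτ ht.1 this
    exact max_eq_right (sub_nonpos.2 this)
  rw [h1, ← integral_add (integrable_const m) (hmax.mono_set hsub)]
  refine setIntegral_congr_fun measurableSet_Ioo fun t ht => ?_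
  have := quantile_antitoneOn hX.aemeasurable (hsub ht) hτ ht.2.le
  simp only at this ⊢
  rw [max_eq_left (sub_nonneg.2 this)]
  ring

/-- Expected shortfall is subadditive. -/
theorem setIntegral_quantile_add_le (hX : Integrable X P) (hY : Integrable Y P) {τ : ℝ}
    (hτ : τ ∈ Icc (0 : ℝ) 1) :
    ∫ t in Ioo 0 τ, quantile P t (fun ω => X ω + Y ω) ≤
      ∫ t in Ioo 0 τ, (quantile P t X + quantile P t Y) := by
  have hsub : Ioo 0 τ ⊆ Ioo (0 : ℝ) 1 := Ioo_subset_Ioo_right hτ.2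
  rw [integral_add ((integrableOn_quantile hX).mono_set hsub)
    ((integrableOn_quantile hY).mono_set hsub)]
  rcases hτ.1.eq_or_lt with rfl | h0
  · simp
  rcases hτ.2.eq_or_lt with rfl | h1
  · rw [integral_quantile (X := fun ω => X ω + Y ω) (hX.add hY).aemeasurable,
      integral_quantile hX.aemeasurable, integral_quantile hY.aemeasurable, integral_add hX hY]
  rw [setIntegral_quantile_eq hX ⟨h0, h1⟩, setIntegral_quantile_eq hY ⟨h0, h1⟩]
  set x := quantile P τ X
  set y := quantile P τ Y
  -- The sum of the two optimal levels is a trial level for `X + Y`; subadditivity of the positive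
  -- part does the rest.
  have h := setIntegral_quantile_le (X := fun ω => X ω + Y ω) (hX.add hY) hτ (x + y)
  have h' : ∫ ω, max (X ω + Y ω - (x + y)) 0 ∂P ≤
      ∫ ω, (max (X ω - x) 0 + max (Y ω - y) 0) ∂P := by
    refine integral_mono (integrable_max_sub (X := fun ω => X ω + Y ω) (hX.add hY) _)
      ((integrable_max_sub hX x).add (integrable_max_sub hY y)) fun ω => ?_
    refine max_le ?_ (by positivity)
    linarith [le_max_left (X ω - x) 0, le_max_left (Y ω - y) 0]
  rw [integral_add (integrable_max_sub hX x) (integrable_max_sub hY y)] at h'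
  linarith

end Quantile

/-! ### The distortion function -/

/-- The expectile at level `u` of an indicator of an event of probability `t`. -/
noncomputable def expectileDistortion (u t : ℝ) : ℝ := (1 - u) * t / (u + (1 - 2 * u) * t)

/-- The derivative of `expectileDistortion u`. -/
noncomputable def expectileDensity (u t : ℝ) : ℝ := (1 - u) * u / (u + (1 - 2 * u) * t) ^ 2

/-- The derivative of `distortion α`. -/
noncomputable def distortionDensity (α t : ℝ) : ℝ :=
  α⁻¹ * ∫ u in Ioc 0 α, expectileDensity u t

section Distortion

variable {α u t x y : ℝ}

theorem level_le_denom (hu' : u ≤ 1 / 2) (ht : 0 ≤ t) : u ≤ u + (1 - 2 * u) * t := by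
  nlinarith

/-- The denominator is affine in `u`, with values `t` at `0` and `1/2` at `1/2`. This bound is
uniform in `u` and serves differentiation under the integral; `level_le_denom` is uniform in `t` and
serves integrability against quantiles. -/
theorem half_le_denom (hu : 0 < u) (hu' : u ≤ 1 / 2) (ht : 0 ≤ t) (ht' : t ≤ 1) :
    t / 2 ≤ u + (1 - 2 * u) * t := by
  nlinarith

theorem denom_pos (hu : 0 < u) (hu' : u ≤ 1 / 2) (ht : 0 ≤ t) : 0 < u + (1 - 2 * u) * t :=
  hu.trans_le (level_le_denom hu' ht)

theorem expectileDistortion_sub (hu : 0 < u) (hu' : u ≤ 1 / 2) (hx : 0 ≤ x) (hy : 0 ≤ y) :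
    expectileDistortion u y - expectileDistortion u x =
      (1 - u) * u * (y - x) / ((u + (1 - 2 * u) * x) * (u + (1 - 2 * u) * y)) := by
  have h1 := (denom_pos hu hu' hx).ne'
  have h2 := (denom_pos hu hu' hy).ne'
  rw [expectileDistortion, expectileDistortion, div_sub_div _ _ h2 h1,
    div_eq_div_iff (mul_ne_zero h2 h1) (mul_ne_zero h1 h2)]
  ring

theorem expectileDistortion_mono (hu : 0 < u) (hu' : u ≤ 1 / 2) (hx : 0 ≤ x) (hxy : x ≤ y) :
    expectileDistortion u x ≤ expectileDistortion u y := by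
  rw [← sub_nonneg, expectileDistortion_sub hu hu' hx (hx.trans hxy)]
  have h1 := denom_pos hu hu' hx
  have h2 := denom_pos hu hu' (hx.trans hxy)
  have : 0 ≤ (1 - u) * u * (y - x) :=
    mul_nonneg (mul_nonneg (by linarith) hu.le) (sub_nonneg.2 hxy)
  positivity

theorem expectileDistortion_zero : expectileDistortion u 0 = 0 := by simp [expectileDistortion]

theorem expectileDistortion_one (hu' : u ≤ 1 / 2) : expectileDistortion u 1 = 1 := by
  rw [expectileDistortion, show u + (1 - 2 * u) * 1 = 1 - u by ring, mul_one]
  exact div_self (by linarith)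

theorem expectileDistortion_mem (hu : 0 < u) (hu' : u ≤ 1 / 2) (ht : t ∈ Icc (0 : ℝ) 1) :
    expectileDistortion u t ∈ Icc (0 : ℝ) 1 :=
  ⟨expectileDistortion_zero.symm.le.trans (expectileDistortion_mono hu hu' le_rfl ht.1),
    (expectileDistortion_mono hu hu' ht.1 ht.2).trans (expectileDistortion_one hu').le⟩

theorem expectileDensity_nonneg (hu : 0 < u) (hu' : u ≤ 1 / 2) : 0 ≤ expectileDensity u t :=
  div_nonneg (mul_nonneg (by linarith) hu.le) (sq_nonneg _)

theorem expectileDensity_anti (hu : 0 < u) (hu' : u ≤ 1 / 2) (hx : 0 ≤ x) (hxy : x ≤ y) :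
    expectileDensity u y ≤ expectileDensity u x := by
  have h1 := denom_pos hu hu' hx
  refine div_le_div_of_nonneg_left (mul_nonneg (by linarith) hu.le) (by positivity) ?_
  exact pow_le_pow_left₀ h1.le (by nlinarith) 2

theorem expectileDensity_le (hu : 0 < u) (hu' : u ≤ 1 / 2) (ht : 0 < t) (ht' : t ≤ 1) :
    expectileDensity u t ≤ 1 / t ^ 2 := by
  have h1 := half_le_denom hu hu' ht.le ht'
  have h2 : (t / 2) ^ 2 ≤ (u + (1 - 2 * u) * t) ^ 2 := pow_le_pow_left₀ (by linarith) h1 2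
  have h3 := denom_pos hu hu' ht.le
  rw [expectileDensity, div_le_div_iff₀ (by positivity) (by positivity)]
  nlinarith [sq_nonneg (1 - 2 * u), sq_nonneg t, mul_nonneg (sq_nonneg (1 - 2 * u)) (sq_nonneg t)]

theorem expectileDensity_le_level (hu : 0 < u) (hu' : u ≤ 1 / 2) (ht : 0 ≤ t) :
    expectileDensity u t ≤ (1 - u) / u := by
  have h1 := level_le_denom hu' ht
  have h2 : u ^ 2 ≤ (u + (1 - 2 * u) * t) ^ 2 := pow_le_pow_left₀ hu.le h1 2
  have h3 := denom_pos hu hu' ht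
  rw [expectileDensity, div_le_div_iff₀ (by positivity) hu]
  nlinarith [mul_le_mul_of_nonneg_left h2 (show 0 ≤ 1 - u by linarith)]

/-- The graph lies below its tangents. -/
theorem expectileDistortion_le_tangent (hu : 0 < u) (hu' : u ≤ 1 / 2) (hx : 0 ≤ x) (hy : 0 ≤ y) :
    expectileDistortion u y ≤ expectileDistortion u x + expectileDensity u x * (y - x) := by
  have h1 := denom_pos hu hu' hx
  have h2 := denom_pos hu hu' hy
  -- The gap to the tangent is an explicit multiple of `(y - x)²`, nonnegative because `u ≤ 1/2`.
  have e : expectileDensity u x * (y - x) - (expectileDistortion u y - expectileDistortion u x) =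
      (1 - u) * u * (1 - 2 * u) * (y - x) ^ 2 /
        ((u + (1 - 2 * u) * x) ^ 2 * (u + (1 - 2 * u) * y)) := by
    rw [expectileDistortion_sub hu hu' hx hy, expectileDensity, div_mul_eq_mul_div,
      div_sub_div _ _ (by positivity) (by positivity),
      div_eq_div_iff (by positivity) (by positivity)]
    ring
  have h3 : 0 ≤ (1 - u) * u * (1 - 2 * u) * (y - x) ^ 2 /
        ((u + (1 - 2 * u) * x) ^ 2 * (u + (1 - 2 * u) * y)) := by
    have : 0 ≤ 1 - u := by linarith
    have : 0 ≤ 1 - 2 * u := by linarith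
    positivity
  linarith

theorem hasDerivAt_expectileDistortion (hu : 0 < u) (hu' : u ≤ 1 / 2) (ht : 0 ≤ t) :
    HasDerivAt (expectileDistortion u) (expectileDensity u t) t := by
  have h := (denom_pos hu hu' ht).ne'
  have h1 : HasDerivAt (fun t => (1 - u) * t) ((1 - u) * 1) t := (hasDerivAt_id t).const_mul _
  have h2 : HasDerivAt (fun t => u + (1 - 2 * u) * t) ((1 - 2 * u) * 1) t :=
    ((hasDerivAt_id t).const_mul _).const_add _
  have h3 := h1.fun_div h2 h
  have e : ((1 - u) * 1 * (u + (1 - 2 * u) * t) - (1 - u) * t * ((1 - 2 * u) * 1)) /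
      (u + (1 - 2 * u) * t) ^ 2 = expectileDensity u t := by
    rw [expectileDensity]
    congr 1
    ring
  rw [e] at h3
  exact h3

theorem lintegral_expectileDensity (hu : 0 < u) (hu' : u ≤ 1 / 2) (hx : 0 ≤ x) (hxy : x ≤ y) :
    ∫⁻ t in Ioo x y, ENNReal.ofReal (expectileDensity u t) =
      ENNReal.ofReal (expectileDistortion u y - expectileDistortion u x) := by
  have hc : ContinuousOn (expectileDensity u) (Icc x y) := by
    refine ContinuousOn.div (by fun_prop) (by fun_prop) fun t ht => ?_
    exact pow_ne_zero _ (denom_pos hu hu' (hx.trans ht.1)).ne'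
  have hi : IntervalIntegrable (expectileDensity u) volume x y :=
    (by rwa [uIcc_of_le hxy] : ContinuousOn _ (uIcc x y)).intervalIntegrable
  rw [← intervalIntegral.integral_eq_sub_of_hasDerivAt (fun t ht =>
    hasDerivAt_expectileDistortion hu hu' (hx.trans (by rw [uIcc_of_le hxy] at ht; exact ht.1))) hi,
    intervalIntegral.integral_of_le hxy, integral_Ioc_eq_integral_Ioo,
    ofReal_integral_eq_lintegral_ofReal
      (((intervalIntegrable_iff_integrableOn_Ioc_of_le hxy).1 hi).mono_set Ioo_subset_Ioc_self)
      (ae_of_all _ fun t => expectileDensity_nonneg hu hu')]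

theorem measurable_expectileDensity :
    Measurable (fun p : ℝ × ℝ => expectileDensity p.1 p.2) := by
  unfold expectileDensity
  fun_prop

theorem integrableOn_expectileDistortion (hα' : α ≤ 1 / 2) (ht : t ∈ Icc (0 : ℝ) 1) :
    IntegrableOn (fun u => expectileDistortion u t) (Ioc 0 α) := by
  refine Measure.integrableOn_of_bounded (M := 1) (by simp) ?_ ?_
  · exact (by unfold expectileDistortion; fun_prop :
      Measurable fun u => expectileDistortion u t).aestronglyMeasurable
  · refine (ae_restrict_iff' measurableSet_Ioc).2 (ae_of_all _ fun u hu => ?_)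
    have := expectileDistortion_mem hu.1 (hu.2.trans hα') ht
    rw [Real.norm_of_nonneg this.1]
    exact this.2

theorem integrableOn_expectileDensity (hα' : α ≤ 1 / 2) (ht : t ∈ Ioo (0 : ℝ) 1) :
    IntegrableOn (fun u => expectileDensity u t) (Ioc 0 α) := by
  refine Measure.integrableOn_of_bounded (M := 1 / t ^ 2) (by simp) ?_ ?_
  · exact (by unfold expectileDensity; fun_prop :
      Measurable fun u => expectileDensity u t).aestronglyMeasurable
  · refine (ae_restrict_iff' measurableSet_Ioc).2 (ae_of_all _ fun u hu => ?_)
    rw [Real.norm_of_nonneg (expectileDensity_nonneg hu.1 (hu.2.trans hα'))]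
    exact expectileDensity_le hu.1 (hu.2.trans hα') ht.1 ht.2.le

/-- The distortion function is the average of the expectiles of an indicator. -/
theorem distortion_eq_integral (hα : 0 < α) (hα' : α ≤ 1 / 2) (ht : t ∈ Icc (0 : ℝ) 1) :
    distortion α t = α⁻¹ * ∫ u in Ioc 0 α, expectileDistortion u t := by
  rw [distortion]
  split_ifs with h0 h1
  · simp [h0, expectileDistortion_zero]
  · rw [← intervalIntegral.integral_of_le hα.le]
    have : ∀ u : ℝ, expectileDistortion u t = 1 - u := fun u => by
      rw [expectileDistortion, h1, show u + (1 - 2 * u) * (1 / 2 : ℝ) = 1 / 2 by ring]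
      field_simp
    simp only [this]
    rw [intervalIntegral.integral_sub (by simp) (by simp), integral_id]
    simp
    field_simp
  · rw [← intervalIntegral.integral_of_le hα.le]
    have htpos : 0 < t := lt_of_le_of_ne ht.1 (Ne.symm h0)
    have hd : 1 - 2 * t ≠ 0 := fun h => h1 (by linarith)
    have hden : ∀ u ∈ uIcc 0 α, 0 < t + u * (1 - 2 * t) := fun u hu => by
      rw [uIcc_of_le hα.le] at hu
      nlinarith [hu.1, hu.2, ht.2]
    -- As a function of `u` the integrand is a quotient of affine functions with denominator `t +
    -- u(1 - 2t)`. Dividing leaves a constant and a multiple of the reciprocal, hence a linear and a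
    -- logarithmic term; the slope `1 - 2t` vanishes exactly in the case split off above.
    have hder : ∀ u ∈ uIcc 0 α, HasDerivAt (fun u => -(t / (1 - 2 * t)) * u +
        t * (1 - t) / (1 - 2 * t) ^ 2 * Real.log (t + u * (1 - 2 * t)))
        (expectileDistortion u t) u := fun u hu => by
      have h := hden u hu
      have h1 : HasDerivAt (fun u => t + u * (1 - 2 * t)) (1 * (1 - 2 * t)) u :=
        ((hasDerivAt_id u).mul_const _).const_add _
      have h2 := ((hasDerivAt_id u).const_mul (-(t / (1 - 2 * t)))).fun_add
        ((h1.log h.ne').const_mul (t * (1 - t) / (1 - 2 * t) ^ 2))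
      refine h2.congr_deriv ?_
      rw [expectileDistortion, show u + (1 - 2 * u) * t = t + u * (1 - 2 * t) by ring]
      have h' := h.ne'
      have key : ∀ D d : ℝ, D ≠ 0 → d ≠ 0 →
          -(t / d) * 1 + t * (1 - t) / d ^ 2 * (1 * d / D) = t / d * ((1 - t - D) / D) := by
        intro D d hD hd
        field_simp
        ring
      rw [key _ _ h' hd, show 1 - t - (t + u * (1 - 2 * t)) = (1 - u) * (1 - 2 * t) by ring]
      generalize t + u * (1 - 2 * t) = D at h' ⊢
      generalize 1 - 2 * t = d at hd ⊢
      field_simp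
    have hci : IntervalIntegrable (fun u => expectileDistortion u t) volume 0 α :=
      (intervalIntegrable_iff_integrableOn_Ioc_of_le hα.le).2
        (integrableOn_expectileDistortion hα' ht)
    rw [intervalIntegral.integral_eq_sub_of_hasDerivAt hder hci]
    have hlog : Real.log (1 - 2 * α + α / t) =
        Real.log (t + α * (1 - 2 * t)) - Real.log t := by
      rw [← Real.log_div (hden α right_mem_uIcc).ne' h0]
      congr 1
      field_simp
      ring
    rw [hlog, zero_mul, add_zero]
    generalize Real.log (t + α * (1 - 2 * t)) = A
    generalize 1 - 2 * t = d at hd ⊢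
    field_simp
    ring

theorem distortion_zero : distortion α 0 = 0 := by simp [distortion]

theorem distortion_one : distortion α 1 = 1 := by
  norm_num [distortion]

theorem distortion_mono (hα : 0 < α) (hα' : α ≤ 1 / 2) :
    MonotoneOn (distortion α) (Icc 0 1) := by
  intro x hx y hy hxy
  rw [distortion_eq_integral hα hα' hx, distortion_eq_integral hα hα' hy]
  refine mul_le_mul_of_nonneg_left ?_ (by positivity)
  exact setIntegral_mono_on (integrableOn_expectileDistortion hα' hx)
    (integrableOn_expectileDistortion hα' hy) measurableSet_Ioc fun u hu =>
      expectileDistortion_mono hu.1 (hu.2.trans hα') hx.1 hxy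

theorem distortion_nonneg (hα : 0 < α) (hα' : α ≤ 1 / 2) (ht : t ∈ Icc (0 : ℝ) 1) :
    0 ≤ distortion α t :=
  distortion_zero.symm.le.trans (distortion_mono hα hα' ⟨le_rfl, zero_le_one⟩ ht ht.1)

theorem distortion_concave (hα : 0 < α) (hα' : α ≤ 1 / 2) :
    ConcaveOn ℝ (Icc 0 1) (distortion α) := by
  refine ⟨convex_Icc 0 1, fun x hx y hy a b ha hb hab => ?_⟩
  have hz : a • x + b • y ∈ Icc (0 : ℝ) 1 := convex_Icc 0 1 hx hy ha hb hab
  rw [distortion_eq_integral hα hα' hx, distortion_eq_integral hα hα' hy,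
    distortion_eq_integral hα hα' hz]
  have hix := integrableOn_expectileDistortion hα' hx
  have hiy := integrableOn_expectileDistortion hα' hy
  have e : a • (α⁻¹ * ∫ u in Ioc 0 α, expectileDistortion u x) +
      b • (α⁻¹ * ∫ u in Ioc 0 α, expectileDistortion u y) =
      α⁻¹ * ∫ u in Ioc 0 α, (a * expectileDistortion u x + b * expectileDistortion u y) := by
    rw [integral_add (hix.const_mul a) (hiy.const_mul b), integral_const_mul, integral_const_mul]
    simp only [smul_eq_mul]
    ring
  rw [e]
  refine mul_le_mul_of_nonneg_left ?_ (by positivity)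
  refine setIntegral_mono_on ((hix.const_mul a).add (hiy.const_mul b))
    (integrableOn_expectileDistortion hα' hz) measurableSet_Ioc fun u hu => ?_
  -- Both points are compared with the tangent at the convex combination `z`; the linear terms
  -- cancel because `a(x - z) + b(y - z) = 0`.
  have h1 := expectileDistortion_le_tangent hu.1 (hu.2.trans hα') hz.1 hx.1
  have h2 := expectileDistortion_le_tangent hu.1 (hu.2.trans hα') hz.1 hy.1
  simp only [smul_eq_mul] at h1 h2 ⊢
  have h3 := add_le_add (mul_le_mul_of_nonneg_left h1 ha) (mul_le_mul_of_nonneg_left h2 hb)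
  refine h3.trans (le_of_eq ?_)
  have hb' : b = 1 - a := by linarith
  subst hb'
  ring

theorem hasDerivAt_distortion (hα : 0 < α) (hα' : α ≤ 1 / 2) (ht : t ∈ Ioo (0 : ℝ) 1) :
    HasDerivAt (distortion α) (distortionDensity α t) t := by
  -- Staying above `t/2` makes the bound on the density uniform over the neighbourhood.
  have hs : Ioo (t / 2) 1 ∈ nhds t := Ioo_mem_nhds (by linarith [ht.1]) ht.2
  have hmem : ∀ x ∈ Ioo (t / 2) 1, x ∈ Ioo (0 : ℝ) 1 := fun x hx =>
    ⟨by linarith [hx.1, ht.1], hx.2⟩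
  have key := hasDerivAt_integral_of_dominated_loc_of_deriv_le (μ := volume.restrict (Ioc 0 α))
    (F := fun x u => expectileDistortion u x) (F' := fun x u => expectileDensity u x)
    (bound := fun _ => 1 / (t / 2) ^ 2) hs
    (Filter.eventually_of_mem hs fun x hx =>
      (integrableOn_expectileDistortion hα' (Ioo_subset_Icc_self (hmem x hx))).1)
    (integrableOn_expectileDistortion hα' (Ioo_subset_Icc_self ht))
    (integrableOn_expectileDensity hα' ht).1
    ((ae_restrict_iff' measurableSet_Ioc).2 (ae_of_all _ fun u hu x hx => by
      rw [Real.norm_of_nonneg (expectileDensity_nonneg hu.1 (hu.2.trans hα'))]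
      refine (expectileDensity_le hu.1 (hu.2.trans hα') (hmem x hx).1 hx.2.le).trans ?_
      have := ht.1
      have := hx.1
      gcongr)) (integrable_const _)
    ((ae_restrict_iff' measurableSet_Ioc).2 (ae_of_all _ fun u hu x hx =>
      hasDerivAt_expectileDistortion hu.1 (hu.2.trans hα') (hmem x hx).1.le))
  refine (key.2.const_mul α⁻¹).congr_of_eventuallyEq ?_
  filter_upwards [hs] with x hx
  exact distortion_eq_integral hα hα' (Ioo_subset_Icc_self (hmem x hx))

theorem derivWithin_distortion (hα : 0 < α) (hα' : α ≤ 1 / 2) (ht : t ∈ Ioo (0 : ℝ) 1) :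
    derivWithin (distortion α) (Ioi t) t = distortionDensity α t :=
  (hasDerivAt_distortion hα hα' ht).hasDerivWithinAt.derivWithin (uniqueDiffWithinAt_Ioi t)

theorem distortionDensity_nonneg (hα : 0 < α) (hα' : α ≤ 1 / 2) : 0 ≤ distortionDensity α t :=
  mul_nonneg (by positivity) (setIntegral_nonneg measurableSet_Ioc fun _ hu =>
    expectileDensity_nonneg hu.1 (hu.2.trans hα'))

theorem distortionDensity_antitoneOn (hα : 0 < α) (hα' : α ≤ 1 / 2) :
    AntitoneOn (distortionDensity α) (Ioo 0 1) := fun _ hx _ hy hxy =>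
  mul_le_mul_of_nonneg_left (setIntegral_mono_on (integrableOn_expectileDensity hα' hy)
    (integrableOn_expectileDensity hα' hx) measurableSet_Ioc fun _ hu =>
      expectileDensity_anti hu.1 (hu.2.trans hα') hx.1.le hxy) (by positivity)

theorem aemeasurable_distortionDensity (hα : 0 < α) (hα' : α ≤ 1 / 2) :
    AEMeasurable (fun t => ENNReal.ofReal (distortionDensity α t))
      (volume.restrict (Ioo (0 : ℝ) 1)) :=
  (aemeasurable_restrict_of_antitoneOn measurableSet_Ioo
    (distortionDensity_antitoneOn hα hα')).ennreal_ofReal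

/-- Tonelli: integration against `φ'` is the average over `u` of integration against `φ_u'`. -/
theorem lintegral_distortionDensity_mul (hα : 0 < α) (hα' : α ≤ 1 / 2) {k : ℝ → ENNReal}
    (hk : AEMeasurable k (volume.restrict (Ioo (0 : ℝ) 1))) :
    ∫⁻ t in Ioo (0 : ℝ) 1, ENNReal.ofReal (distortionDensity α t) * k t =
      ENNReal.ofReal α⁻¹ * ∫⁻ u in Ioc 0 α, ∫⁻ t in Ioo (0 : ℝ) 1,
        ENNReal.ofReal (expectileDensity u t) * k t := by
  have hm : Measurable fun p : ℝ × ℝ => ENNReal.ofReal (expectileDensity p.1 p.2) :=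
    measurable_expectileDensity.ennreal_ofReal
  rw [lintegral_lintegral_swap (hm.aemeasurable.mul hk.comp_snd),
    ← lintegral_const_mul' _ _ ENNReal.ofReal_ne_top]
  refine setLIntegral_congr_fun measurableSet_Ioo fun t ht => ?_
  have hmt : Measurable fun u => ENNReal.ofReal (expectileDensity u t) :=
    hm.comp measurable_prodMk_right
  rw [lintegral_mul_const _ hmt, ← mul_assoc, distortionDensity,
    ENNReal.ofReal_mul (by positivity), ofReal_integral_eq_lintegral_ofReal
      (integrableOn_expectileDensity hα' ht)
      ((ae_restrict_iff' measurableSet_Ioc).2 (ae_of_all _ fun u hu =>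
        expectileDensity_nonneg hu.1 (hu.2.trans hα')))]

theorem lintegral_expectileDistortion (hα : 0 < α) (hα' : α ≤ 1 / 2) (ht : t ∈ Icc (0 : ℝ) 1) :
    ENNReal.ofReal α⁻¹ * ∫⁻ u in Ioc 0 α, ENNReal.ofReal (expectileDistortion u t) =
      ENNReal.ofReal (distortion α t) := by
  rw [distortion_eq_integral hα hα' ht, ENNReal.ofReal_mul (by positivity),
    ofReal_integral_eq_lintegral_ofReal (integrableOn_expectileDistortion hα' ht)
      ((ae_restrict_iff' measurableSet_Ioc).2 (ae_of_all _ fun u hu =>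
        (expectileDistortion_mem hu.1 (hu.2.trans hα') ht).1))]

/-- Exchanging the integrals first means that only the densities `φ_u'`, continuous up to `0`, are
integrated by the fundamental theorem; `φ'` itself is unbounded near `0`. -/
theorem lintegral_distortionDensity (hα : 0 < α) (hα' : α ≤ 1 / 2) {p : ℝ}
    (hp : p ∈ Icc (0 : ℝ) 1) :
    ∫⁻ t in Ioo (0 : ℝ) 1, ENNReal.ofReal (distortionDensity α t) * (Ioo 0 p).indicator 1 t =
      ENNReal.ofReal (distortion α p) := by
  rw [lintegral_distortionDensity_mul hα hα'
    (measurable_one.indicator measurableSet_Ioo).aemeasurable,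
    ← lintegral_expectileDistortion hα hα' hp]
  congr 1
  refine setLIntegral_congr_fun measurableSet_Ioc fun u hu => ?_
  have h := lintegral_expectileDensity hu.1 (hu.2.trans hα') le_rfl hp.1
  rw [expectileDistortion_zero, sub_zero] at h
  have e : ∀ t, ENNReal.ofReal (expectileDensity u t) * (Ioo 0 p).indicator 1 t =
      (Ioo 0 p).indicator (fun t => ENNReal.ofReal (expectileDensity u t)) t := fun t => by
    by_cases ht : t ∈ Ioo 0 p <;> simp [ht]
  rw [← h, lintegral_congr e, lintegral_indicator measurableSet_Ioo,
    Measure.restrict_restrict measurableSet_Ioo,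
    inter_eq_left.2 (Ioo_subset_Ioo_right hp.2 : Ioo 0 p ⊆ Ioo (0 : ℝ) 1)]

/-- The probability measure on `(0, 1)` with density `φ'`. -/
noncomputable def distortionMeasure (α : ℝ) : Measure ℝ :=
  (volume.restrict (Ioo (0 : ℝ) 1)).withDensity fun t => ENNReal.ofReal (distortionDensity α t)

theorem distortionMeasure_ac : distortionMeasure α ≪ volume.restrict (Ioo (0 : ℝ) 1) :=
  withDensity_absolutelyContinuous _ _

theorem ae_distortionMeasure_mem : ∀ᵐ t ∂distortionMeasure α, t ∈ Ioo (0 : ℝ) 1 :=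
  distortionMeasure_ac.ae_le (ae_restrict_mem measurableSet_Ioo)

theorem lintegral_distortionMeasure (hα : 0 < α) (hα' : α ≤ 1 / 2) {k : ℝ → ENNReal}
    (hk : AEMeasurable k (volume.restrict (Ioo (0 : ℝ) 1))) :
    ∫⁻ t, k t ∂distortionMeasure α =
      ∫⁻ t in Ioo (0 : ℝ) 1, ENNReal.ofReal (distortionDensity α t) * k t :=
  lintegral_withDensity_eq_lintegral_mul₀ (aemeasurable_distortionDensity hα hα') hk

theorem distortionMeasure_Ioo (hα : 0 < α) (hα' : α ≤ 1 / 2) {p : ℝ} (hp : p ∈ Icc (0 : ℝ) 1) :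
    distortionMeasure α (Ioo 0 p) = ENNReal.ofReal (distortion α p) := by
  rw [← lintegral_distortionDensity hα hα' hp, ← lintegral_distortionMeasure hα hα'
    (measurable_one.indicator measurableSet_Ioo).aemeasurable, lintegral_indicator_one measurableSet_Ioo]

theorem isProbabilityMeasure_distortionMeasure (hα : 0 < α) (hα' : α ≤ 1 / 2) :
    IsProbabilityMeasure (distortionMeasure α) := by
  refine ⟨?_⟩
  have h : distortionMeasure α univ = distortionMeasure α (Ioo 0 1) :=
    measure_congr (ae_distortionMeasure_mem.mono fun t ht => propext ⟨fun _ => ht, fun _ => trivial⟩)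
  rw [h, distortionMeasure_Ioo hα hα' ⟨zero_le_one, le_rfl⟩, distortion_one, ENNReal.ofReal_one]

end Distortion

/-! ### The distortion risk measure -/

section DistortionRisk

variable {Ω : Type*} [MeasurableSpace Ω] {P : Measure Ω} {α : ℝ} {X Y : Ω → ℝ}

theorem aemeasurable_Lp (L : Lp ℝ 1 P) : AEMeasurable L P := (Lp.aestronglyMeasurable L).aemeasurable

theorem distortionRisk_isLawInvariant :
    IsLawInvariant P (distortionRisk P (distortion α)) := by
  intro L₁ L₂ h
  simp only [distortionRisk, quantile_eq_of_map_eq (aemeasurable_Lp L₁) (aemeasurable_Lp L₂) h]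

variable [IsProbabilityMeasure P]

theorem aemeasurable_quantile_distortionMeasure (hX : AEMeasurable X P) :
    AEMeasurable (fun t => quantile P t X) (distortionMeasure α) :=
  (aemeasurable_quantile hX).mono_ac distortionMeasure_ac

/-- Absorbing `φ' ≥ 0` into the measure makes `R_φ` an unweighted integral of the quantile function
over a probability space. -/
theorem distortionRisk_eq_extInt (hα : 0 < α) (hα' : α ≤ 1 / 2) (L : Lp ℝ 1 P) :
    distortionRisk P (distortion α) L =
      extInt (distortionMeasure α) (fun t => quantile P t L) := by
  have hq := aemeasurable_quantile (aemeasurable_Lp L)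
  have hqn : AEMeasurable (fun t => ENNReal.ofReal (-quantile P t L))
    (volume.restrict (Ioo (0 : ℝ) 1)) := hq.neg.ennreal_ofReal
  rw [distortionRisk, extIntegral, extInt, lintegral_distortionMeasure hα hα' hq.ennreal_ofReal,
    lintegral_distortionMeasure hα hα' hqn]
  congr 2 <;> refine setLIntegral_congr_fun measurableSet_Ioo fun t ht => ?_
  · rw [derivWithin_distortion hα hα' ht, ENNReal.ofReal_mul (distortionDensity_nonneg hα hα')]
  · rw [derivWithin_distortion hα hα' ht, ← mul_neg,
      ENNReal.ofReal_mul (distortionDensity_nonneg hα hα')]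

/-- The weight `φ'` can be large only near `0` and `-q` only near `1`. On each side of `1/2` one of
the two factors is bounded by its value at `1/2`, and the other is integrable. -/
theorem lintegral_neg_quantile_ne_top (hα : 0 < α) (hα' : α ≤ 1 / 2) (hX : Integrable X P) :
    ∫⁻ t, ENNReal.ofReal (-quantile P t X) ∂distortionMeasure α ≠ ⊤ := by
  have hq := aemeasurable_quantile hX.aemeasurable
  have hqn : AEMeasurable (fun t => ENNReal.ofReal (-quantile P t X))
    (volume.restrict (Ioo (0 : ℝ) 1)) := hq.neg.ennreal_ofReal
  have hψ := aemeasurable_distortionDensity hα hα'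
  have hhalf : (1 / 2 : ℝ) ∈ Ioo (0 : ℝ) 1 := by norm_num
  have h1 : ∫⁻ t in Ioo (0 : ℝ) 1, ENNReal.ofReal (distortionDensity α t) ≠ ⊤ := by
    have := isProbabilityMeasure_distortionMeasure hα hα'
    have h := measure_ne_top (distortionMeasure α) univ
    rwa [distortionMeasure, withDensity_apply _ MeasurableSet.univ, Measure.restrict_univ] at h
  have h2 : ∫⁻ t in Ioo (0 : ℝ) 1, ENNReal.ofReal (-quantile P t X) ≠ ⊤ :=
    lintegral_ofReal_ne_top (integrableOn_quantile hX).neg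
  rw [lintegral_distortionMeasure hα hα' hqn]
  refine ne_top_of_le_ne_top ?_ (setLIntegral_mono' measurableSet_Ioo
    (g := fun t => ENNReal.ofReal (distortionDensity α t) * ENNReal.ofReal (-quantile P (1 / 2) X) +
      ENNReal.ofReal (distortionDensity α (1 / 2)) * ENNReal.ofReal (-quantile P t X))
    fun t ht => ?_)
  · rw [lintegral_add_left' (hψ.mul_const _), lintegral_mul_const' _ _ ENNReal.ofReal_ne_top,
      lintegral_const_mul' _ _ ENNReal.ofReal_ne_top]
    exact ENNReal.add_ne_top.2 ⟨ENNReal.mul_ne_top h1 ENNReal.ofReal_ne_top,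
      ENNReal.mul_ne_top ENNReal.ofReal_ne_top h2⟩
  · rcases le_total t (1 / 2) with h | h
    · refine le_add_right (mul_le_mul_right (ENNReal.ofReal_le_ofReal (neg_le_neg ?_)) _)
      exact quantile_antitoneOn hX.aemeasurable ht hhalf h
    · refine le_add_left (mul_le_mul_left (ENNReal.ofReal_le_ofReal ?_) _)
      exact distortionDensity_antitoneOn hα hα' hhalf ht h

/-- The partial integrals `∫_0^τ q` are subadditive for every `τ`, and `φ'` is a decreasing weight,
so `lintegral_antitone_weight_mono` applies in cross form. -/
theorem extInt_quantile_add_le (hα : 0 < α) (hα' : α ≤ 1 / 2) (hX : Integrable X P)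
    (hY : Integrable Y P) :
    extInt (distortionMeasure α) (fun t => quantile P t (fun ω => X ω + Y ω)) ≤
      extInt (distortionMeasure α) (fun t => quantile P t X) +
        extInt (distortionMeasure α) (fun t => quantile P t Y) := by
  have hZ : Integrable (fun ω => X ω + Y ω) P := hX.add hY
  have hfX := lintegral_neg_quantile_ne_top hα hα' hX
  have hfY := lintegral_neg_quantile_ne_top hα hα' hY
  have hqX := aemeasurable_quantile hX.aemeasurable
  have hqY := aemeasurable_quantile hY.aemeasurable
  have hqZ := aemeasurable_quantile hZ.aemeasurable
  have hqXY : AEMeasurable (fun t => quantile P t X + quantile P t Y)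
    (volume.restrict (Ioo (0 : ℝ) 1)) := hqX.add hqY
  have hnXY : AEMeasurable (fun t => ENNReal.ofReal (-(quantile P t X + quantile P t Y)))
    (volume.restrict (Ioo (0 : ℝ) 1)) := hqXY.neg.ennreal_ofReal
  have hnX : AEMeasurable (fun t => ENNReal.ofReal (-quantile P t X))
    (distortionMeasure α) := (hqX.mono_ac distortionMeasure_ac).neg.ennreal_ofReal
  have hnZ : AEMeasurable (fun t => ENNReal.ofReal (-quantile P t (fun ω => X ω + Y ω)))
    (volume.restrict (Ioo (0 : ℝ) 1)) := hqZ.neg.ennreal_ofReal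
  rw [← extInt_add (hqX.mono_ac distortionMeasure_ac) (hqY.mono_ac distortionMeasure_ac) hfX hfY]
  refine extInt_le_extInt (lintegral_neg_quantile_ne_top hα hα' hZ) ?_ ?_
  · refine ne_top_of_le_ne_top (ENNReal.add_ne_top.2 ⟨hfX, hfY⟩) ?_
    rw [← lintegral_add_left' hnX]
    refine lintegral_mono fun t => ?_
    rw [neg_add]
    exact ENNReal.ofReal_add_le
  · rw [← lintegral_add_left' (hqZ.mono_ac distortionMeasure_ac).ennreal_ofReal,
      ← lintegral_add_left' (hqXY.mono_ac distortionMeasure_ac).ennreal_ofReal]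
    refine (lintegral_distortionMeasure hα hα' (hqZ.ennreal_ofReal.add hnXY)).le.trans
      (le_trans ?_ (lintegral_distortionMeasure hα hα' (hqXY.ennreal_ofReal.add hnZ)).ge)
    refine lintegral_antitone_weight_mono zero_le_one (distortionDensity_antitoneOn hα hα')
      (fun t _ => distortionDensity_nonneg hα hα') (hqZ.ennreal_ofReal.add hnXY)
      (hqXY.ennreal_ofReal.add hnZ) fun τ hτ => ?_
    have hsub : Ioo 0 τ ⊆ Ioo (0 : ℝ) 1 := Ioo_subset_Ioo_right hτ.2
    exact lintegral_cross_le ((integrableOn_quantile hZ).mono_set hsub)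
      (((integrableOn_quantile hX).mono_set hsub).add ((integrableOn_quantile hY).mono_set hsub))
      (setIntegral_quantile_add_le hX hY hτ)

theorem distortionRisk_isCoherent (hα : 0 < α) (hα' : α ≤ 1 / 2) :
    IsCoherent P (distortionRisk P (distortion α)) := by
  have hprob := isProbabilityMeasure_distortionMeasure hα hα'
  have hint : ∀ L : Lp ℝ 1 P, Integrable L P := L1.integrable_coeFn
  have hfin : ∀ L : Lp ℝ 1 P, _ := fun L => lintegral_neg_quantile_ne_top hα hα' (hint L)
  refine ⟨fun L => ?_, fun L₁ L₂ h => ?_, fun L m => ?_, fun L₁ L₂ => ?_, fun L c hc => ?_⟩ <;>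
    simp only [distortionRisk_eq_extInt hα hα']
  · exact extInt_ne_bot (hfin L)
  · refine extInt_mono_ae (ae_distortionMeasure_mem.mono fun t ht => ?_)
    exact quantile_mono (aemeasurable_Lp L₁) (aemeasurable_Lp L₂) ((Lp.coeFn_le L₁ L₂).2 h) ht
  · have h : (L - Lp.const 1 P m : Lp ℝ 1 P) =ᵐ[P] fun ω => L ω + -m := by
      filter_upwards [Lp.coeFn_sub L (Lp.const 1 P m), Lp.coeFn_const (p := 1) (μ := P) m]
        with ω h1 h2
      rw [h1, Pi.sub_apply, h2, Function.const_apply, sub_eq_add_neg]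
    have e : (fun t => quantile P t (L - Lp.const 1 P m : Lp ℝ 1 P)) =ᵐ[distortionMeasure α]
        fun t => quantile P t L + -m := ae_distortionMeasure_mem.mono fun t ht => by
      simp only
      rw [quantile_congr_ae h, quantile_add_const (aemeasurable_Lp L) _ ht]
    rw [extInt_congr_ae e, extInt_add (aemeasurable_quantile_distortionMeasure (aemeasurable_Lp L))
      aemeasurable_const (hfin L) (by simp), extInt_const, EReal.coe_neg, sub_eq_add_neg]
  · have e : (fun t => quantile P t (L₁ + L₂ : Lp ℝ 1 P)) =
        fun t => quantile P t (fun ω => L₁ ω + L₂ ω) := funext fun t =>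
      quantile_congr_ae (Lp.coeFn_add L₁ L₂) t
    rw [e]
    exact extInt_quantile_add_le hα hα' (hint L₁) (hint L₂)
  · have e : (fun t => quantile P t (c • L : Lp ℝ 1 P)) =ᵐ[distortionMeasure α]
        fun t => c * quantile P t L := ae_distortionMeasure_mem.mono fun t ht => by
      simp only
      rw [quantile_congr_ae (Lp.coeFn_smul c L), ← quantile_const_mul (aemeasurable_Lp L) hc ht]
      rfl
    rw [extInt_congr_ae e, extInt_const_mul hc (hfin L)]

theorem distortionRisk_isComonotonic (hα : 0 < α) (hα' : α ≤ 1 / 2) :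
    IsComonotonic P (distortionRisk P (distortion α)) := by
  rintro L₁ L₂ ⟨f, g, hf, hg, hfg⟩
  have hfin : ∀ L : Lp ℝ 1 P, _ := fun L =>
    lintegral_neg_quantile_ne_top hα hα' (L1.integrable_coeFn L)
  simp only [distortionRisk_eq_extInt hα hα']
  have h : (L₁ + L₂ : Lp ℝ 1 P) =ᵐ[P] fun ω => f ω + g ω := by
    filter_upwards [Lp.coeFn_add L₁ L₂, hf, hg] with ω h1 h2 h3
    rw [h1, Pi.add_apply, h2, h3]
  have e : (fun t => quantile P t (L₁ + L₂ : Lp ℝ 1 P)) =ᵐ[distortionMeasure α]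
      fun t => quantile P t L₁ + quantile P t L₂ := ae_distortionMeasure_mem.mono fun t ht => by
    simp only
    rw [quantile_congr_ae h, ← quantile_congr_ae hf, ← quantile_congr_ae hg]
    exact quantile_add_of_comonotone ((aemeasurable_Lp L₁).congr hf.symm)
      ((aemeasurable_Lp L₂).congr hg.symm) hfg ht
  rw [extInt_congr_ae e, extInt_add (aemeasurable_quantile_distortionMeasure (aemeasurable_Lp L₁))
    (aemeasurable_quantile_distortionMeasure (aemeasurable_Lp L₂)) (hfin L₁) (hfin L₂)]

theorem distortionRisk_indicator (hα : 0 < α) (hα' : α ≤ 1 / 2) {A : Set Ω}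
    (hA : MeasurableSet A) :
    distortionRisk P (distortion α) (indicatorConstLp 1 hA (measure_ne_top P A) (1 : ℝ)) =
      ((distortion α (P.real A) : ℝ) : EReal) := by
  have hp : P.real A ∈ Icc (0 : ℝ) 1 := ⟨measureReal_nonneg, measureReal_le_one⟩
  have e : (fun t => quantile P t (indicatorConstLp 1 hA (measure_ne_top P A) (1 : ℝ)))
      =ᵐ[distortionMeasure α] (Ioo 0 (P.real A)).indicator 1 :=
    ae_distortionMeasure_mem.mono fun t ht => by
      simp only
      rw [quantile_congr_ae indicatorConstLp_coeFn, quantile_indicator hA ht]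
      by_cases h : t < P.real A
      · simp [h, ht.1]
      · simp [h]
  have h1 : ∀ t : ℝ, ENNReal.ofReal ((Ioo 0 (P.real A)).indicator 1 t) =
      (Ioo 0 (P.real A)).indicator 1 t := fun t => by
    by_cases h : t ∈ Ioo 0 (P.real A) <;> simp [h]
  have h2 : ∀ t : ℝ, ENNReal.ofReal (-(Ioo 0 (P.real A)).indicator 1 t) = 0 := fun t => by
    by_cases h : t ∈ Ioo 0 (P.real A) <;> simp [h]
  rw [distortionRisk_eq_extInt hα hα', extInt_congr_ae e, extInt, lintegral_congr h1,
    lintegral_congr h2, lintegral_indicator_one measurableSet_Ioo, distortionMeasure_Ioo hα hα' hp,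
    lintegral_zero, EReal.coe_ennreal_zero, sub_zero, EReal.coe_ennreal_ofReal,
    max_eq_left (distortion_nonneg hα hα' hp)]

end DistortionRisk

/-! ### Expectiles -/

section Expectile

variable {Ω : Type*} [MeasurableSpace Ω] {P : Measure Ω} {α u : ℝ} {X Y : Ω → ℝ}

theorem ofReal_integral_posPart {β : Type*} [MeasurableSpace β] {μ : Measure β} {f : β → ℝ}
    (hf : Integrable f μ) :
    ENNReal.ofReal (∫ x, (f x)⁺ ∂μ) = ∫⁻ x, ENNReal.ofReal (f x) ∂μ := by
  have hpos : Integrable (fun x => (f x)⁺) μ := hf.pos_part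
  rw [ofReal_integral_eq_lintegral_ofReal hpos (ae_of_all _ fun _ => posPart_nonneg _)]
  refine lintegral_congr fun x => ?_
  rcases le_total (f x) 0 with h | h
  · rw [posPart_eq_zero.2 h, ENNReal.ofReal_zero, ENNReal.ofReal_of_nonpos h]
  · rw [posPart_of_nonneg h]

variable [IsProbabilityMeasure P]

theorem isExpectile_expectile (hu : 0 < u) (hu' : u ≤ 1 / 2) (hX : Integrable X P) :
    IsExpectile P u X (expectile P u X) :=
  Classical.epsilon_spec (existsUnique_isExpectile P hu hu' hX).exists

theorem expectile_eq (hu : 0 < u) (hu' : u ≤ 1 / 2) (hX : Integrable X P) {m : ℝ}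
    (hm : IsExpectile P u X m) : expectile P u X = m :=
  (existsUnique_isExpectile P hu hu' hX).unique (isExpectile_expectile hu hu' hX) hm

/-- Since `1 - u ≥ u`, the first order condition forces `E[(X - e)⁺] ≤ E[(X - e)⁻]`. The bound keeps
`es_α` above `-∞` and controls the lower tail in the minimality argument. -/
theorem integral_le_expectile (hu : 0 < u) (hu' : u ≤ 1 / 2) (hX : Integrable X P) :
    ∫ ω, X ω ∂P ≤ expectile P u X := by
  have h := isExpectile_expectile hu hu' hX
  set e := expectile P u X
  have hXe : Integrable (fun ω => X ω - e) P := hX.sub (integrable_const e)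
  have h1 : ∫ ω, (X ω - e) ∂P = ∫ ω, (X ω - e)⁺ ∂P - ∫ ω, (X ω - e)⁻ ∂P := by
    have hpos : Integrable (fun ω => (X ω - e)⁺) P := hXe.pos_part
    have hneg : Integrable (fun ω => (X ω - e)⁻) P := hXe.neg_part
    rw [← integral_sub hpos hneg]
    exact integral_congr_ae (ae_of_all _ fun ω => (posPart_sub_negPart (X ω - e)).symm)
  rw [integral_sub hX (integrable_const e), integral_const, probReal_univ, one_smul] at h1
  have hp : 0 ≤ ∫ ω, (X ω - e)⁺ ∂P := integral_nonneg fun _ => posPart_nonneg _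
  unfold IsExpectile at h
  nlinarith

theorem lintegral_isExpectile (hu : 0 < u) (hu' : u ≤ 1 / 2) (hX : Integrable X P) {e : ℝ}
    (h : IsExpectile P u X e) :
    ENNReal.ofReal (1 - u) * ∫⁻ ω, ENNReal.ofReal (X ω - e) ∂P =
      ENNReal.ofReal u * ∫⁻ ω, ENNReal.ofReal (e - X ω) ∂P := by
  have hXe : Integrable (fun ω => X ω - e) P := hX.sub (integrable_const e)
  have hXe' : Integrable (fun ω => e - X ω) P := (integrable_const e).sub hX
  rw [← ofReal_integral_posPart hXe, ← ofReal_integral_posPart hXe',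
    ← ENNReal.ofReal_mul (by linarith), ← ENNReal.ofReal_mul hu.le, h]
  congr 3
  funext ω
  rw [← neg_sub e, negPart_neg]

theorem setLIntegral_le_of_eq_zero {a b c d : ℝ} {F : ℝ → ENNReal} (τ : ℝ)
    (h : ∀ x ∈ Ioo a b, x ≠ τ → x ∉ Ioo c d → F x = 0) :
    ∫⁻ x in Ioo a b, F x ≤ ∫⁻ x in Ioo c d, F x := by
  have hτ : ∀ᵐ x ∂(volume : Measure ℝ), x ≠ τ := by simp [ae_iff]
  rw [← lintegral_indicator (μ := volume) (s := Ioo c d) measurableSet_Ioo F]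
  refine (lintegral_mono_ae ?_).trans (setLIntegral_le_lintegral (Ioo a b) _)
  filter_upwards [ae_restrict_mem measurableSet_Ioo, ae_restrict_of_ae hτ] with x hx hx'
  by_cases hxc : x ∈ Ioo c d
  · simp [hxc]
  · simp [hxc, h x hx hx' hxc]

/-- This is `∫ φ_u' (q - e) ≥ 0` in split form. On each side of the crossing point `p` the density
is compared with the slope of the chord of `φ_u`, and the first order condition balances the two
chord integrals. -/
theorem lintegral_expectileDensity_quantile_le (hu : 0 < u) (hu' : u ≤ 1 / 2)
    (hX : Integrable X P) {e : ℝ} (he : IsExpectile P u X e) :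
    ∫⁻ t in Ioo (0 : ℝ) 1, ENNReal.ofReal (e - quantile P t X) *
        ENNReal.ofReal (expectileDensity u t) ≤
      ∫⁻ t in Ioo (0 : ℝ) 1, ENNReal.ofReal (quantile P t X - e) *
        ENNReal.ofReal (expectileDensity u t) := by
  have hm := hX.aemeasurable
  set p : ℝ := 1 - P.real {ω | X ω ≤ e} with hp
  have hp0 : 0 ≤ p := sub_nonneg.2 measureReal_le_one
  have hp1 : p ≤ 1 := sub_le_self _ measureReal_nonneg
  have hlt : ∀ t ∈ Ioo (0 : ℝ) 1, t < p → 0 ≤ quantile P t X - e := fun t ht h =>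
    sub_nonneg.2 ((lt_quantile_iff hm ht).2 (by linarith)).le
  have hge : ∀ t ∈ Ioo (0 : ℝ) 1, p ≤ t → 0 ≤ e - quantile P t X := fun t ht h =>
    sub_nonneg.2 ((quantile_le_iff hm ht).2 (by linarith))
  have hsubl : Ioo 0 p ⊆ Ioo (0 : ℝ) 1 := Ioo_subset_Ioo_right hp1
  have hsubr : Ioo p 1 ⊆ Ioo (0 : ℝ) 1 := Ioo_subset_Ioo_left hp0
  have hdm : Measurable fun t => ENNReal.ofReal (expectileDensity u t) :=
    (measurable_expectileDensity.comp measurable_prodMk_left).ennreal_ofReal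
  set D := u + (1 - 2 * u) * p with hD
  have hDpos : 0 < D := denom_pos hu hu' hp0
  have h1u : 0 ≤ 1 - u := by linarith
  calc ∫⁻ t in Ioo (0 : ℝ) 1, ENNReal.ofReal (e - quantile P t X) *
        ENNReal.ofReal (expectileDensity u t)
      ≤ ∫⁻ t in Ioo p 1, ENNReal.ofReal (e - quantile P t X) *
        ENNReal.ofReal (expectileDensity u t) := by
        refine setLIntegral_le_of_eq_zero p fun t ht hne hnot => ?_
        have htp : t < p := lt_of_le_of_ne (not_lt.1 fun h => hnot ⟨h, ht.2⟩) hne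
        rw [ENNReal.ofReal_of_nonpos (by linarith [hlt t ht htp]), zero_mul]
    -- Here `u/D` is the slope of the chord of `φ_u` over `[p, 1]`; concavity gives `1 - φ_u(τ) ≤
    -- (u/D)(1 - τ)` for `τ ≥ p`, and `e - q` is increasing.
    _ ≤ ∫⁻ t in Ioo p 1, ENNReal.ofReal (e - quantile P t X) * ENNReal.ofReal (u / D) := by
        refine lintegral_monotone_weight_mono hp1 (fun x hx y hy hxy => ?_)
          (fun t ht => hge t (hsubr ht) ht.1.le) hdm.aemeasurable aemeasurable_const fun τ hτ => ?_
        · exact sub_le_sub_left (quantile_antitoneOn hm (hsubr hx) (hsubr hy) hxy) e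
        · have hτ0 : 0 ≤ τ := hp0.trans hτ.1
          have hDτ := denom_pos hu hu' hτ0
          rw [lintegral_expectileDensity hu hu' hτ0 hτ.2, lintegral_const,
            Measure.restrict_apply_univ, Real.volume_Ioo, ← ENNReal.ofReal_mul (by positivity),
            expectileDistortion_sub hu hu' hτ0 zero_le_one]
          refine ENNReal.ofReal_le_ofReal ?_
          have e1 : (1 - u) * u * (1 - τ) / ((u + (1 - 2 * u) * τ) * (u + (1 - 2 * u) * 1)) =
              u * (1 - τ) / (u + (1 - 2 * u) * τ) := by
            rw [show u + (1 - 2 * u) * 1 = 1 - u by ring,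
              show (1 - u) * u * (1 - τ) = u * (1 - τ) * (1 - u) by ring]
            exact mul_div_mul_right _ _ (by linarith)
          rw [e1, div_mul_eq_mul_div]
          refine div_le_div_of_nonneg_left (mul_nonneg hu.le (sub_nonneg.2 hτ.2)) hDpos ?_
          nlinarith [hτ.1]
    _ = ENNReal.ofReal (u / D) * ∫⁻ t in Ioo p 1, ENNReal.ofReal (e - quantile P t X) := by
        rw [lintegral_mul_const' _ _ ENNReal.ofReal_ne_top, mul_comm]
    _ ≤ ENNReal.ofReal (u / D) * ∫⁻ t in Ioo (0 : ℝ) 1, ENNReal.ofReal (e - quantile P t X) := by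
        exact mul_le_mul_right (lintegral_mono_set hsubr) _
    -- The first order condition, transported from `X` to its quantile function.
    _ = ENNReal.ofReal ((1 - u) / D) *
          ∫⁻ t in Ioo (0 : ℝ) 1, ENNReal.ofReal (quantile P t X - e) := by
        rw [lintegral_quantile hm (k := fun x => ENNReal.ofReal (e - x)) (by fun_prop),
          lintegral_quantile hm (k := fun x => ENNReal.ofReal (x - e)) (by fun_prop),
          div_eq_inv_mul, div_eq_inv_mul, ENNReal.ofReal_mul (by positivity),
          ENNReal.ofReal_mul (by positivity), mul_assoc, mul_assoc,
          lintegral_isExpectile hu hu' hX he]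
    _ ≤ ENNReal.ofReal ((1 - u) / D) *
          ∫⁻ t in Ioo 0 p, ENNReal.ofReal (quantile P t X - e) := by
        refine mul_le_mul_right (setLIntegral_le_of_eq_zero p fun t ht hne hnot => ?_) _
        have htp : p ≤ t := not_lt.1 fun h => hnot ⟨ht.1, h⟩
        exact ENNReal.ofReal_of_nonpos (by linarith [hge t ht htp])
    _ = ∫⁻ t in Ioo 0 p, ENNReal.ofReal (quantile P t X - e) * ENNReal.ofReal ((1 - u) / D) := by
        rw [lintegral_mul_const' _ _ ENNReal.ofReal_ne_top, mul_comm]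
    -- Here `(1-u)/D` is the slope of the chord over `[0, p]`; concavity gives `φ_u(τ) ≥ ((1-u)/D)τ`
    -- for `τ ≤ p`, and `q - e` is decreasing.
    _ ≤ ∫⁻ t in Ioo 0 p, ENNReal.ofReal (quantile P t X - e) *
          ENNReal.ofReal (expectileDensity u t) := by
        refine lintegral_antitone_weight_mono hp0 (fun x hx y hy hxy => ?_)
          (fun t ht => hlt t (hsubl ht) ht.2) aemeasurable_const hdm.aemeasurable fun τ hτ => ?_
        · exact sub_le_sub_right (quantile_antitoneOn hm (hsubl hx) (hsubl hy) hxy) e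
        · have hDτ := denom_pos hu hu' hτ.1
          have hτ0 := hτ.1
          rw [lintegral_expectileDensity hu hu' le_rfl hτ.1, lintegral_const,
            Measure.restrict_apply_univ, Real.volume_Ioo, ← ENNReal.ofReal_mul (by positivity),
            expectileDistortion_zero, sub_zero, sub_zero, expectileDistortion]
          refine ENNReal.ofReal_le_ofReal ?_
          rw [div_mul_eq_mul_div]
          refine div_le_div_of_nonneg_left (by positivity) hDτ ?_
          nlinarith [hτ.2]
    _ ≤ _ := lintegral_mono_set hsubl

/-- The expectile is dominated by the distortion risk measure of its distortion function. -/
theorem expectile_le_integral (hu : 0 < u) (hu' : u ≤ 1 / 2) (hX : Integrable X P) :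
    IntegrableOn (fun t => expectileDensity u t * quantile P t X) (Ioo 0 1) ∧
      expectile P u X ≤ ∫ t in Ioo (0 : ℝ) 1, expectileDensity u t * quantile P t X := by
  set e := expectile P u X
  have hd0 : ∀ t, 0 ≤ expectileDensity u t := fun t => expectileDensity_nonneg hu hu'
  have hdm : Measurable (expectileDensity u) :=
    measurable_expectileDensity.comp measurable_prodMk_left
  have hbound : ∀ᵐ t ∂volume.restrict (Ioo (0 : ℝ) 1), ‖expectileDensity u t‖ ≤ (1 - u) / u :=
    (ae_restrict_iff' measurableSet_Ioo).2 (ae_of_all _ fun t ht => by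
      rw [Real.norm_of_nonneg (hd0 t)]
      exact expectileDensity_le_level hu hu' ht.1.le)
  have hdi : IntegrableOn (expectileDensity u) (Ioo 0 1) :=
    Measure.integrableOn_of_bounded (by simp) hdm.aestronglyMeasurable hbound
  have hi : IntegrableOn (fun t => expectileDensity u t * quantile P t X) (Ioo 0 1) :=
    (integrableOn_quantile hX).bdd_mul hdm.aestronglyMeasurable hbound
  refine ⟨hi, ?_⟩
  -- Total mass one lets the constant `e` be written as `∫ φ_u' e`.
  have hone : ∫ t in Ioo (0 : ℝ) 1, expectileDensity u t = 1 := by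
    rw [integral_eq_lintegral_of_nonneg_ae (ae_of_all _ hd0) hdm.aestronglyMeasurable,
      lintegral_expectileDensity hu hu' le_rfl zero_le_one, expectileDistortion_zero,
      expectileDistortion_one hu']
    simp
  have hdiff : IntegrableOn (fun t => expectileDensity u t * quantile P t X -
      expectileDensity u t * e) (Ioo 0 1) := hi.sub (hdi.mul_const e)
  have key : 0 ≤ ∫ t in Ioo (0 : ℝ) 1,
      (expectileDensity u t * quantile P t X - expectileDensity u t * e) := by
    rw [integral_eq_lintegral_pos_part_sub_lintegral_neg_part hdiff, sub_nonneg]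
    refine ENNReal.toReal_mono (lintegral_ofReal_ne_top hdiff) ?_
    have h := lintegral_expectileDensity_quantile_le hu hu' hX (isExpectile_expectile hu hu' hX)
    convert h using 3 with t t
    · rw [← ENNReal.ofReal_mul' (hd0 t)]
      congr 1
      ring
    · rw [← ENNReal.ofReal_mul' (hd0 t)]
      congr 1
      ring
  rw [integral_sub hi (hdi.mul_const e), integral_mul_const, hone, one_mul] at key
  linarith

/-- For `e ∈ [0, 1]` and `p = P[A]` the first order condition reads `(1-u)p(1-e) = u(1-p)e`, whose
solution is `φ_u(p)`. -/
theorem expectile_indicator (hu : 0 < u) (hu' : u ≤ 1 / 2) {A : Set Ω} (hA : MeasurableSet A)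
    (hX : X =ᵐ[P] A.indicator fun _ => (1 : ℝ)) :
    expectile P u X = expectileDistortion u (P.real A) := by
  have hp : P.real A ∈ Icc (0 : ℝ) 1 := ⟨measureReal_nonneg, measureReal_le_one⟩
  have hI : Integrable (A.indicator fun _ => (1 : ℝ)) P := (integrable_const 1).indicator hA
  refine expectile_eq hu hu' (hI.congr hX.symm) ?_
  set e := expectileDistortion u (P.real A) with he
  have hmem := expectileDistortion_mem hu hu' hp
  have e1 : ∫ ω, (X ω - e)⁺ ∂P = P.real A * (1 - e) := by
    have : (fun ω => (X ω - e)⁺) =ᵐ[P] A.indicator fun _ => 1 - e := hX.mono fun ω hω => by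
      simp only [hω]
      by_cases h : ω ∈ A
      · simpa [h] using hmem.2
      · simpa [h] using hmem.1
    rw [integral_congr_ae this, integral_indicator_const _ hA, smul_eq_mul]
  have e2 : ∫ ω, (X ω - e)⁻ ∂P = (1 - P.real A) * e := by
    have : (fun ω => (X ω - e)⁻) =ᵐ[P] Aᶜ.indicator fun _ => e := hX.mono fun ω hω => by
      simp only [hω]
      by_cases h : ω ∈ A
      · simpa [h] using hmem.2
      · simpa [h] using hmem.1
    rw [integral_congr_ae this, integral_indicator_const _ hA.compl, smul_eq_mul,
      probReal_compl_eq_one_sub hA]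
  rw [IsExpectile, e1, e2, he, expectileDistortion]
  have := (denom_pos hu hu' hp.1).ne'
  generalize hD : u + (1 - 2 * u) * P.real A = D at this ⊢
  field_simp
  rw [← hD]
  ring

end Expectile

/-! ### Expectile based expected shortfall -/

section ExpectileES

variable {Ω : Type*} [MeasurableSpace Ω] {P : Measure Ω} [IsProbabilityMeasure P] {α : ℝ}

theorem isProbabilityMeasure_smul_restrict_Ioc (hα : 0 < α) :
    IsProbabilityMeasure (ENNReal.ofReal α⁻¹ • volume.restrict (Ioc 0 α)) := by
  refine ⟨?_⟩
  rw [Measure.smul_apply, Measure.restrict_apply_univ, Real.volume_Ioc, smul_eq_mul,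
    ← ENNReal.ofReal_mul (by positivity), sub_zero, inv_mul_cancel₀ hα.ne', ENNReal.ofReal_one]

theorem lintegral_neg_expectile_ne_top (hα' : α ≤ 1 / 2) (L : Lp ℝ 1 P) :
    ∫⁻ u in Ioc 0 α, ENNReal.ofReal (-expectile P u L) ≠ ⊤ := by
  refine ne_top_of_le_ne_top ?_ (setLIntegral_mono' measurableSet_Ioc
    (g := fun _ => ENNReal.ofReal (-∫ ω, L ω ∂P)) fun u hu => ENNReal.ofReal_le_ofReal
      (neg_le_neg (integral_le_expectile hu.1 (hu.2.trans hα') (L1.integrable_coeFn L))))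
  rw [lintegral_const]
  exact ENNReal.mul_ne_top ENNReal.ofReal_ne_top (measure_ne_top _ _)

theorem expectileES_eq_extInt (hα : 0 < α) (hα' : α ≤ 1 / 2) (L : Lp ℝ 1 P) :
    expectileES P α L = extInt (ENNReal.ofReal α⁻¹ • volume.restrict (Ioc 0 α))
      (fun u => expectile P u L) :=
  (extInt_smul_measure (by positivity) (lintegral_neg_expectile_ne_top hα' L)).symm

theorem integral_le_expectileES (hα : 0 < α) (hα' : α ≤ 1 / 2) (L : Lp ℝ 1 P) :
    ((∫ ω, L ω ∂P : ℝ) : EReal) ≤ expectileES P α L := by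
  have := isProbabilityMeasure_smul_restrict_Ioc hα
  rw [expectileES_eq_extInt hα hα',
    ← extInt_const (μ := ENNReal.ofReal α⁻¹ • volume.restrict (Ioc 0 α)) (∫ ω, L ω ∂P)]
  refine extInt_mono_ae (Measure.ae_smul_measure ?_ _)
  exact (ae_restrict_iff' measurableSet_Ioc).2 (ae_of_all _ fun u hu =>
    integral_le_expectile hu.1 (hu.2.trans hα') (L1.integrable_coeFn L))

theorem expectileES_le_distortionRisk (hα : 0 < α) (hα' : α ≤ 1 / 2) (L : Lp ℝ 1 P) :
    expectileES P α L ≤ distortionRisk P (distortion α) L := by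
  have hL := L1.integrable_coeFn L
  have hq := aemeasurable_quantile (aemeasurable_Lp L)
  have hqn : AEMeasurable (fun t => ENNReal.ofReal (-quantile P t L))
    (volume.restrict (Ioo (0 : ℝ) 1)) := hq.neg.ennreal_ofReal
  have hes : ∫⁻ u, ENNReal.ofReal (-expectile P u L)
      ∂(ENNReal.ofReal α⁻¹ • volume.restrict (Ioc 0 α)) ≠ ⊤ := by
    rw [lintegral_smul_measure]
    exact ENNReal.mul_ne_top ENNReal.ofReal_ne_top (lintegral_neg_expectile_ne_top hα' L)
  rw [expectileES_eq_extInt hα hα', distortionRisk_eq_extInt hα hα']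
  refine coe_sub_le_coe_sub hes (lintegral_neg_quantile_ne_top hα hα' hL) ?_
  rw [lintegral_smul_measure, lintegral_smul_measure,
    lintegral_distortionMeasure hα hα' hq.ennreal_ofReal, lintegral_distortionMeasure hα hα' hqn,
    lintegral_distortionDensity_mul hα hα' hq.ennreal_ofReal,
    lintegral_distortionDensity_mul hα hα' hqn, smul_eq_mul, smul_eq_mul, ← mul_add, ← mul_add]
  -- Superadditivity of the lower integral holds for arbitrary functions, so measurability of `u ↦
  -- e_u` is not needed; on the other side the quantile term is measurable.
  refine mul_le_mul_right ((le_lintegral_add _ _).trans ?_) _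
  have hA : AEMeasurable (fun u => ∫⁻ t in Ioo (0 : ℝ) 1,
      ENNReal.ofReal (expectileDensity u t) * ENNReal.ofReal (quantile P t L))
      (volume.restrict (Ioc 0 α)) :=
    AEMeasurable.lintegral_prod_right'
      (f := fun p : ℝ × ℝ => ENNReal.ofReal (expectileDensity p.1 p.2) *
        ENNReal.ofReal (quantile P p.2 L))
      (measurable_expectileDensity.ennreal_ofReal.aemeasurable.mul hq.ennreal_ofReal.comp_snd)
  rw [← lintegral_add_left' hA]
  refine setLIntegral_mono' measurableSet_Ioc fun u hu => ?_
  have hu' := hu.2.trans hα'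
  obtain ⟨hi, hle⟩ := expectile_le_integral hu.1 hu' hL
  have hprob : IsProbabilityMeasure (volume.restrict (Ioo (0 : ℝ) 1)) := ⟨by simp⟩
  have h := lintegral_cross_le (f := fun _ => expectile P u L)
    (integrable_const (μ := volume.restrict (Ioo (0 : ℝ) 1)) _) hi (by simpa using hle)
  rw [lintegral_add_left measurable_const, lintegral_add_right _ measurable_const, lintegral_const,
    lintegral_const, measure_univ, mul_one, mul_one] at h
  simpa only [← mul_neg, ENNReal.ofReal_mul (expectileDensity_nonneg hu.1 hu')] using h

theorem expectileES_indicator (hα : 0 < α) (hα' : α ≤ 1 / 2) {A : Set Ω} (hA : MeasurableSet A) :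
    expectileES P α (indicatorConstLp 1 hA (measure_ne_top P A) (1 : ℝ)) =
      ((distortion α (P.real A) : ℝ) : EReal) := by
  have hp : P.real A ∈ Icc (0 : ℝ) 1 := ⟨measureReal_nonneg, measureReal_le_one⟩
  have e : (fun u => expectile P u (indicatorConstLp 1 hA (measure_ne_top P A) (1 : ℝ)))
      =ᵐ[ENNReal.ofReal α⁻¹ • volume.restrict (Ioc 0 α)]
        fun u => expectileDistortion u (P.real A) :=
    Measure.ae_smul_measure ((ae_restrict_iff' measurableSet_Ioc).2 (ae_of_all _ fun u hu =>
      expectile_indicator hu.1 (hu.2.trans hα') hA indicatorConstLp_coeFn)) _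
  have hneg : ∫⁻ u in Ioc 0 α, ENNReal.ofReal (-expectileDistortion u (P.real A)) = 0 := by
    rw [← lintegral_zero (μ := volume.restrict (Ioc 0 α))]
    refine setLIntegral_congr_fun measurableSet_Ioc fun u hu => ENNReal.ofReal_of_nonpos ?_
    linarith [(expectileDistortion_mem hu.1 (hu.2.trans hα') hp).1]
  rw [expectileES_eq_extInt hα hα', extInt_congr_ae e, extInt, lintegral_smul_measure,
    lintegral_smul_measure, hneg, smul_zero, smul_eq_mul, lintegral_expectileDistortion hα hα' hp,
    EReal.coe_ennreal_zero, sub_zero, EReal.coe_ennreal_ofReal,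
    max_eq_left (distortion_nonneg hα hα' hp)]

end ExpectileES

/-! ### Staircase approximation -/

/-- The staircase with `N` steps of height and width `δ`. -/
noncomputable def staircase (δ : ℝ) : ℕ → ℝ → ℝ
  | 0, _ => 0
  | N + 1, x => staircase δ N x + δ * if (N + 1 : ℝ) * δ < x then 1 else 0

section Staircase

variable {δ : ℝ}

theorem monotone_step (hδ : 0 ≤ δ) (c : ℝ) : Monotone fun x => δ * if c < x then 1 else 0 := by
  intro x y hxy
  simp only
  split_ifs with h1 h2 <;> first | exact absurd (h1.trans_le hxy) h2 | linarith

theorem staircase_monotone (hδ : 0 ≤ δ) (N : ℕ) : Monotone (staircase δ N) := by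
  induction N with
  | zero => exact monotone_const
  | succ N ih => exact ih.add (monotone_step hδ _)

theorem staircase_eq (hδ : 0 ≤ δ) (N : ℕ) {x : ℝ} (h : N * δ < x) : staircase δ N x = N * δ := by
  induction N with
  | zero => simp [staircase]
  | succ N ih =>
    push_cast at h
    rw [staircase, ih (by linarith), if_pos h]
    push_cast
    ring

theorem staircase_le (hδ : 0 ≤ δ) (N : ℕ) {x : ℝ} (hx : 0 ≤ x) : staircase δ N x ≤ x := by
  induction N with
  | zero => exact hx
  | succ N ih =>
    rw [staircase]
    split_ifs with h
    · rw [staircase_eq hδ N (by linarith)]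
      linarith
    · linarith

/-- The jumps sit at `δ, 2δ, …, Nδ`, so up to height `Nδ` the staircase lags behind the identity by
at most one step. -/
theorem le_staircase (hδ : 0 ≤ δ) (N : ℕ) (x : ℝ) : min x (N * δ) ≤ staircase δ N x + δ := by
  induction N with
  | zero => simpa [staircase] using Or.inr hδ
  | succ N ih =>
    rw [staircase]
    push_cast
    split_ifs with h
    · rw [staircase_eq hδ N (by linarith)]
      exact (min_le_right _ _).trans (by linarith)
    · refine (min_le_left _ _).trans ?_
      rcases lt_or_ge (N * δ) x with h' | h'
      · rw [staircase_eq hδ N h']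
        linarith
      · rw [min_eq_left h'] at ih
        linarith

end Staircase

theorem EReal_le_of_forall_le_add {a b : EReal} (h : ∀ ε : ℝ, 0 < ε → a ≤ b + ε) : a ≤ b := by
  induction b with
  | top => exact le_top
  | bot => simpa using h 1 one_pos
  | coe b =>
    induction a with
    | top => exact absurd (h 1 one_pos) (not_le.2 (EReal.coe_lt_top (b + 1)))
    | bot => exact bot_le
    | coe a =>
      rw [EReal.coe_le_coe_iff]
      refine le_of_forall_pos_le_add fun ε hε => ?_
      have := h ε hε
      rwa [← EReal.coe_add, EReal.coe_le_coe_iff] at this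

/-! ### Minimality of the distortion risk measure -/

section Minimality

variable {Ω : Type*} [MeasurableSpace Ω] {P : Measure Ω}

theorem comonotone_of_monotone {L L₁ L₂ : Lp ℝ 1 P} {f g : ℝ → ℝ} (hf : Monotone f)
    (hg : Monotone g) (h₁ : L₁ =ᵐ[P] fun ω => f (L ω)) (h₂ : L₂ =ᵐ[P] fun ω => g (L ω)) :
    Comonotone P L₁ L₂ := by
  refine ⟨fun ω => f (L ω), fun ω => g (L ω), h₁.symm, h₂.symm, fun ω ω' => ?_⟩
  rcases le_total (L ω) (L ω') with h | h
  · exact mul_nonneg_of_nonpos_of_nonpos (sub_nonpos.2 (hf h)) (sub_nonpos.2 (hg h))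
  · exact mul_nonneg (sub_nonneg.2 (hf h)) (sub_nonneg.2 (hg h))

variable [IsProbabilityMeasure P] {α : ℝ} {R W : Lp ℝ 1 P → EReal}

theorem IsCoherent.map_zero (hR : IsCoherent P R) : R 0 = 0 := by
  have := hR.pos_homogeneous 0 0 le_rfl
  rwa [smul_zero, EReal.coe_zero, zero_mul] at this

/-- Comonotonic coherent risk measures that are ordered on indicators are ordered on staircases. -/
theorem exists_staircase_le (hW : IsCoherent P W) (hW' : IsComonotonic P W) (hR : IsCoherent P R)
    (hR' : IsComonotonic P R)
    (hind : ∀ (A : Set Ω) (hA : MeasurableSet A),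
      W (indicatorConstLp 1 hA (measure_ne_top P A) (1 : ℝ)) ≤
        R (indicatorConstLp 1 hA (measure_ne_top P A) (1 : ℝ)))
    (L : Lp ℝ 1 P) {δ : ℝ} (hδ : 0 ≤ δ) (N : ℕ) :
    ∃ S : Lp ℝ 1 P, S =ᵐ[P] (fun ω => staircase δ N (L ω)) ∧ W S ≤ R S := by
  induction N with
  | zero =>
    refine ⟨0, ?_, ?_⟩
    · filter_upwards [Lp.coeFn_zero ℝ 1 P] with ω h
      rw [h]; rfl
    · rw [hW.map_zero, hR.map_zero]
  | succ N ih =>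
    obtain ⟨S, hS, hle⟩ := ih
    have hA : MeasurableSet {ω | (N + 1 : ℝ) * δ < L ω} :=
      measurableSet_lt measurable_const (Lp.stronglyMeasurable L).measurable
    set I := indicatorConstLp 1 hA (measure_ne_top P _) (1 : ℝ)
    have hI : (δ • I : Lp ℝ 1 P) =ᵐ[P] fun ω => δ * if (N + 1 : ℝ) * δ < L ω then 1 else 0 := by
      filter_upwards [Lp.coeFn_smul δ I, indicatorConstLp_coeFn (p := 1) (hs := hA)
        (hμs := measure_ne_top P _) (c := (1 : ℝ))] with ω h1 h2
      rw [h1, Pi.smul_apply, h2, smul_eq_mul]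
      by_cases h : (N + 1 : ℝ) * δ < L ω <;> simp [h]
    -- The staircase built so far and the next step are increasing functions of the same `L`, so
    -- both risk measures split over their sum.
    have hco : Comonotone P S (δ • I) :=
      comonotone_of_monotone (staircase_monotone hδ N) (monotone_step hδ _) hS hI
    refine ⟨S + δ • I, ?_, ?_⟩
    · filter_upwards [Lp.coeFn_add S (δ • I), hS, hI] with ω h1 h2 h3
      rw [h1, Pi.add_apply, h2, h3, staircase]
    · rw [hW' _ _ hco, hR' _ _ hco, hW.pos_homogeneous _ _ hδ, hR.pos_homogeneous _ _ hδ]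
      exact add_le_add hle (mul_le_mul_of_nonneg_left (hind _ hA) (EReal.coe_nonneg.2 hδ))

theorem IsCoherent.add_const (hR : IsCoherent P R) (L : Lp ℝ 1 P) (m : ℝ) :
    R (L + Lp.const 1 P m) = R L + m := by
  have h := hR.cash_invariant L (-m)
  rwa [map_neg, sub_neg_eq_add, EReal.coe_neg, sub_eq_add_neg, neg_neg] at h

/-- No continuity of a competing `R` is available, so the passage to unbounded `L` is made on the
side of `R_φ`, by monotone convergence of the truncated quantiles. -/
theorem distortionRisk_le_of_forall_inf_const (hα : 0 < α) (hα' : α ≤ 1 / 2) {L : Lp ℝ 1 P}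
    (hL : 0 ≤ L) {δ : ℝ} (hδ : 0 < δ) {b : EReal}
    (h : ∀ N : ℕ, distortionRisk P (distortion α) (L ⊓ Lp.const 1 P (N * δ)) ≤ b) :
    distortionRisk P (distortion α) L ≤ b := by
  have hm := aemeasurable_Lp L
  have hq := aemeasurable_quantile_distortionMeasure (α := α) hm
  have hL0 : (fun _ => (0 : ℝ)) ≤ᵐ[P] L := by
    filter_upwards [(Lp.coeFn_le 0 L).2 hL, Lp.coeFn_zero ℝ 1 P] with ω h1 h2
    rwa [h2] at h1
  have hq0 : ∀ t ∈ Ioo (0 : ℝ) 1, 0 ≤ quantile P t L := fun t ht => by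
    rw [← quantile_const (P := P) 0 ht]
    exact quantile_mono aemeasurable_const hm hL0 ht
  have hnn : ∀ c : ℝ, 0 ≤ c → extInt (distortionMeasure α) (fun t => min (quantile P t L) c) =
      ((∫⁻ t, ENNReal.ofReal (min (quantile P t L) c) ∂distortionMeasure α : ENNReal) : EReal) := by
    intro c hc
    have : ∫⁻ t, ENNReal.ofReal (-min (quantile P t L) c) ∂distortionMeasure α = 0 := by
      rw [← lintegral_zero (μ := distortionMeasure α)]
      refine lintegral_congr_ae (ae_distortionMeasure_mem.mono fun t ht => ?_)
      exact ENNReal.ofReal_of_nonpos (neg_nonpos.2 (le_min (hq0 t ht) hc))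
    rw [extInt, this, EReal.coe_ennreal_zero, sub_zero]
  have hb : ∀ N : ℕ, ((∫⁻ t, ENNReal.ofReal (min (quantile P t L) (N * δ))
      ∂distortionMeasure α : ENNReal) : EReal) ≤ b := by
    intro N
    rw [← hnn _ (by positivity)]
    refine le_trans (le_of_eq ?_) (h N)
    rw [distortionRisk_eq_extInt hα hα']
    refine extInt_congr_ae (ae_distortionMeasure_mem.mono fun t ht => ?_)
    have hinf : (L ⊓ Lp.const 1 P (N * δ) : Lp ℝ 1 P) =ᵐ[P] fun ω => min (L ω) (N * δ) := by
      filter_upwards [Lp.coeFn_inf L (Lp.const 1 P (N * δ)),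
        Lp.coeFn_const (p := 1) (μ := P) (N * δ)] with ω h1 h2
      rw [h1, Pi.inf_apply, h2]; rfl
    simp only
    rw [quantile_congr_ae hinf, quantile_min_const hm _ ht]
  have hlim : Filter.Tendsto (fun N : ℕ => ∫⁻ t, ENNReal.ofReal (min (quantile P t L) (N * δ))
      ∂distortionMeasure α) Filter.atTop
      (nhds (∫⁻ t, ENNReal.ofReal (quantile P t L) ∂distortionMeasure α)) := by
    refine lintegral_tendsto_of_tendsto_of_monotone
      (fun N => (hq.min aemeasurable_const).ennreal_ofReal)
      (ae_of_all _ fun t M N hMN => ENNReal.ofReal_le_ofReal (min_le_min le_rfl ?_))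
      (ae_of_all _ fun t => ?_)
    · exact mul_le_mul_of_nonneg_right (by exact_mod_cast hMN) hδ.le
    · refine tendsto_const_nhds.congr' ?_
      obtain ⟨M, hM⟩ := exists_nat_gt (quantile P t L / δ)
      filter_upwards [Filter.eventually_ge_atTop M] with N hN
      rw [min_eq_left]
      have : (M : ℝ) ≤ N := by exact_mod_cast hN
      exact ((div_lt_iff₀ hδ).1 (hM.trans_le this)).le
  have hneg : ∫⁻ t, ENNReal.ofReal (-quantile P t L) ∂distortionMeasure α = 0 := by
    rw [← lintegral_zero (μ := distortionMeasure α)]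
    refine lintegral_congr_ae (ae_distortionMeasure_mem.mono fun t ht => ?_)
    exact ENNReal.ofReal_of_nonpos (neg_nonpos.2 (hq0 t ht))
  rw [distortionRisk_eq_extInt hα hα', extInt, hneg, EReal.coe_ennreal_zero, sub_zero]
  exact le_of_tendsto' ((continuous_coe_ennreal_ereal.tendsto _).comp hlim) hb

/-- The staircase satisfies `S ≤ L` and `min(L, Nδ) ≤ S + δ`. Hence `R_φ(min(L, Nδ)) ≤ R_φ(S) + δ ≤
R(S) + δ ≤ R(L) + δ`, and `N → ∞` precedes `δ → 0`. -/
theorem distortionRisk_le_of_nonneg (hα : 0 < α) (hα' : α ≤ 1 / 2) (hR : IsCoherent P R)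
    (hR' : IsComonotonic P R) (hdom : ∀ L, expectileES P α L ≤ R L)
    {L : Lp ℝ 1 P} (hL : 0 ≤ L) :
    distortionRisk P (distortion α) L ≤ R L := by
  have hW := distortionRisk_isCoherent (P := P) hα hα'
  refine EReal_le_of_forall_le_add fun δ hδ => ?_
  refine distortionRisk_le_of_forall_inf_const hα hα' hL hδ fun N => ?_
  obtain ⟨S, hS, hle⟩ := exists_staircase_le hW (distortionRisk_isComonotonic hα hα') hR hR'
    (fun A hA => by
      rw [distortionRisk_indicator hα hα' hA, ← expectileES_indicator hα hα' hA]
      exact hdom _) L hδ.le N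
  have hSL : S ≤ L := by
    refine (Lp.coeFn_le S L).1 ?_
    filter_upwards [(Lp.coeFn_le 0 L).2 hL, Lp.coeFn_zero ℝ 1 P, hS] with ω h1 h2 h3
    rw [h3]
    rw [h2] at h1
    exact staircase_le hδ.le N h1
  have hLS : L ⊓ Lp.const 1 P (N * δ) ≤ S + Lp.const 1 P δ := by
    refine (Lp.coeFn_le _ _).1 ?_
    filter_upwards [Lp.coeFn_inf L (Lp.const 1 P (N * δ)), Lp.coeFn_add S (Lp.const 1 P δ),
      Lp.coeFn_const (p := 1) (μ := P) (N * δ), Lp.coeFn_const (p := 1) (μ := P) δ, hS]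
      with ω h1 h2 h3 h4 h5
    rw [h1, h2, Pi.inf_apply, Pi.add_apply, h3, h4, h5]
    exact le_staircase hδ.le N (L ω)
  calc distortionRisk P (distortion α) (L ⊓ Lp.const 1 P (N * δ))
      ≤ distortionRisk P (distortion α) (S + Lp.const 1 P δ) := hW.monotone _ _ hLS
    _ = distortionRisk P (distortion α) S + δ := hW.add_const S δ
    _ ≤ R L + δ := add_le_add (hle.trans (hR.monotone _ _ hSL)) le_rfl

theorem distortionRisk_le_of_bddBelow (hα : 0 < α) (hα' : α ≤ 1 / 2) (hR : IsCoherent P R)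
    (hR' : IsComonotonic P R) (hdom : ∀ L, expectileES P α L ≤ R L)
    {L : Lp ℝ 1 P} {k : ℝ} (hL : Lp.const 1 P (-k) ≤ L) :
    distortionRisk P (distortion α) L ≤ R L := by
  have h0 : 0 ≤ L + Lp.const 1 P k := by
    rw [map_neg] at hL
    exact neg_le_iff_add_nonneg.1 hL
  have h := distortionRisk_le_of_nonneg hα hα' hR hR' hdom h0
  have e : L = (L + Lp.const 1 P k) - Lp.const 1 P k := (add_sub_cancel_right _ _).symm
  rw [e, (distortionRisk_isCoherent hα hα').cash_invariant, hR.cash_invariant]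
  exact EReal.sub_le_sub h le_rfl

/-- The distortion risk measure is minimal among the comonotonic coherent risk measures that
dominate the expectile based expected shortfall. -/
theorem distortionRisk_le (hα : 0 < α) (hα' : α ≤ 1 / 2) (hR : IsCoherent P R)
    (hR' : IsComonotonic P R) (hdom : ∀ L, expectileES P α L ≤ R L)
    (L : Lp ℝ 1 P) : distortionRisk P (distortion α) L ≤ R L := by
  have hW := distortionRisk_isCoherent (P := P) hα hα'
  have hL := L1.integrable_coeFn L
  -- The part of `L` below `-k` has vanishing mean, by dominated convergence with bound `|L|`.
  have hlim : Filter.Tendsto (fun k : ℕ => ∫ ω, min (L ω + k) 0 ∂P) Filter.atTop (nhds 0) := by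
    have h0 : ∫ _, (0 : ℝ) ∂P = 0 := integral_zero _ _
    refine Eq.subst (motive := fun c => Filter.Tendsto (fun k : ℕ => ∫ ω, min (L ω + k) 0 ∂P)
      Filter.atTop (nhds c)) h0 ?_
    refine tendsto_integral_of_dominated_convergence (fun ω => |L ω|)
      (fun k => ((hL.aestronglyMeasurable.add aestronglyMeasurable_const).inf
        aestronglyMeasurable_const)) hL.abs (fun k => ae_of_all _ fun ω => ?_)
      (ae_of_all _ fun ω => ?_)
    · have hk : (0 : ℝ) ≤ k := k.cast_nonneg
      rw [Real.norm_eq_abs, abs_of_nonpos (min_le_right _ _)]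
      rcases min_cases (L ω + k) 0 with h | h
      · rw [h.1]
        linarith [neg_le_abs (L ω)]
      · rw [h.1, neg_zero]
        exact abs_nonneg _
    · refine tendsto_const_nhds.congr' ?_
      obtain ⟨M, hM⟩ := exists_nat_gt (-L ω)
      filter_upwards [Filter.eventually_ge_atTop M] with N hN
      have : (M : ℝ) ≤ N := by exact_mod_cast hN
      exact (min_eq_right (by linarith)).symm
  refine EReal_le_of_forall_le_add fun ε hε => ?_
  obtain ⟨k, hk⟩ := (hlim.eventually (lt_mem_nhds (show -ε < 0 by linarith))).exists
  set M : Lp ℝ 1 P := L ⊔ Lp.const 1 P (-(k : ℝ)) with hMdef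
  set T : Lp ℝ 1 P := (L + Lp.const 1 P (k : ℝ)) ⊓ 0 with hTdef
  have hM : M =ᵐ[P] fun ω => max (L ω) (-(k : ℝ)) := by
    filter_upwards [Lp.coeFn_sup L (Lp.const 1 P (-(k : ℝ))),
      Lp.coeFn_const (p := 1) (μ := P) (-(k : ℝ))] with ω h1 h2
    rw [hMdef, h1, Pi.sup_apply, h2]; rfl
  have hT : T =ᵐ[P] fun ω => min (L ω + k) 0 := by
    filter_upwards [Lp.coeFn_inf (L + Lp.const 1 P (k : ℝ)) 0, Lp.coeFn_add L (Lp.const 1 P (k : ℝ)),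
      Lp.coeFn_const (p := 1) (μ := P) (k : ℝ), Lp.coeFn_zero ℝ 1 P] with ω h1 h2 h3 h4
    rw [hTdef, h1, Pi.inf_apply, h2, Pi.add_apply, h3, h4]; rfl
  have hco : Comonotone P M T := comonotone_of_monotone
    (f := fun x => max x (-(k : ℝ))) (g := fun x => min (x + k) 0)
    (fun x y h => max_le_max h le_rfl)
    (fun x y h => min_le_min (add_le_add h le_rfl) le_rfl) hM hT
  have hsum : L = M + T := by
    refine Lp.ext ?_
    filter_upwards [Lp.coeFn_add M T, hM, hT] with ω h1 h2 h3
    rw [h1, Pi.add_apply, h2, h3]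
    rcases le_total (L ω) (-(k : ℝ)) with h | h
    · rw [max_eq_right h, min_eq_left (by linarith)]
      ring
    · rw [max_eq_left h, min_eq_right (by linarith), add_zero]
  have h1 : distortionRisk P (distortion α) L ≤ R M :=
    (hW.monotone _ _ le_sup_left).trans
      (distortionRisk_le_of_bddBelow hα hα' hR hR' hdom (k := k) le_sup_right)
  -- Domination is used here beyond indicators: `R(T) ≥ es_α(T) ≥ E[T] > -ε`.
  have h2 : ((-ε : ℝ) : EReal) ≤ R T := by
    refine le_trans ?_ ((integral_le_expectileES hα hα' T).trans (hdom T))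
    rw [EReal.coe_le_coe_iff, integral_congr_ae hT]
    exact hk.le
  have h3 : R L = R M + R T := by
    rw [← hR' _ _ hco, ← hsum]
  calc distortionRisk P (distortion α) L ≤ R M + ((-ε : ℝ) : EReal) + ε := by
        rw [add_assoc, ← EReal.coe_add, neg_add_cancel, EReal.coe_zero, add_zero]
        exact h1
    _ ≤ R L + ε := by
        rw [h3]
        exact add_le_add (add_le_add le_rfl h2) le_rfl

end Minimality

end ExpectileRisk

/-! ### The four claims on `φ`, `es_α` and `R_φ` combined. -/

theorem proposition4p1 {Ω : Type*} [MeasurableSpace Ω] (P : Measure Ω) [IsProbabilityMeasure P]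
    (hP : ExpectileRisk.IsAtomless P) (α : ℝ) (hα : 0 < α) (hα' : α ≤ 1 / 2) :
    -- `φ` is a concave distortion function
    (ConcaveOn ℝ (Icc 0 1) (ExpectileRisk.distortion α) ∧
      MonotoneOn (ExpectileRisk.distortion α) (Icc 0 1) ∧
      ExpectileRisk.distortion α 0 = 0 ∧ ExpectileRisk.distortion α 1 = 1) ∧
    -- `-∞ < es_α ≤ R_φ` on `L¹`
    (∀ L : Lp ℝ 1 P, ExpectileRisk.expectileES P α L ≠ ⊥ ∧
      ExpectileRisk.expectileES P α L ≤
        ExpectileRisk.distortionRisk P (ExpectileRisk.distortion α) L) ∧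
    -- `R_φ` is the smallest law invariant, coherent, comonotonic risk measure dominating `es_α`
    IsLeast {R : Lp ℝ 1 P → EReal |
        ExpectileRisk.IsLawInvariant P R ∧ ExpectileRisk.IsCoherent P R ∧
        ExpectileRisk.IsComonotonic P R ∧ ∀ L, ExpectileRisk.expectileES P α L ≤ R L}
      (ExpectileRisk.distortionRisk P (ExpectileRisk.distortion α)) ∧
    -- the three agree on indicators
    (∀ (A : Set Ω) (hA : MeasurableSet A),
      ExpectileRisk.expectileES P α (indicatorConstLp 1 hA (measure_ne_top P A) (1 : ℝ)) =
          ((ExpectileRisk.distortion α (P.real A) : ℝ) : EReal) ∧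
      ExpectileRisk.distortionRisk P (ExpectileRisk.distortion α)
          (indicatorConstLp 1 hA (measure_ne_top P A) (1 : ℝ)) =
          ((ExpectileRisk.distortion α (P.real A) : ℝ) : EReal)) := by
  have hdom := ExpectileRisk.expectileES_le_distortionRisk (P := P) hα hα'
  refine ⟨⟨ExpectileRisk.distortion_concave hα hα', ExpectileRisk.distortion_mono hα hα',
    ExpectileRisk.distortion_zero, ExpectileRisk.distortion_one⟩, fun L => ⟨?_, hdom L⟩,
    ⟨⟨ExpectileRisk.distortionRisk_isLawInvariant, ExpectileRisk.distortionRisk_isCoherent hα hα',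
      ExpectileRisk.distortionRisk_isComonotonic hα hα', hdom⟩, ?_⟩,
    fun A hA => ⟨ExpectileRisk.expectileES_indicator hα hα' hA,
      ExpectileRisk.distortionRisk_indicator hα hα' hA⟩⟩
  · exact ((EReal.bot_lt_coe _).trans_le
      (ExpectileRisk.integral_le_expectileES hα hα' L)).ne'
  · rintro R ⟨-, hR, hR', hRdom⟩ L
    exact ExpectileRisk.distortionRisk_le hα hα' hR hR' hRdom L
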